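/- Let $d\in[0,\tfrac12)$ and let $\{\tau_k\}_{k\in\mathbb Z}$ be generated by the Long-Memory Stochastic Duration (LMSD) model with memory parameter $d$ under a probability measure $P^0$ (with expectation $E^0$), that is, $$\tau_k=e^{h_k}\epsilon_k,\qquad h_k=\sum_{j=0}^\infty b_j e_{k-j}\qquad(k\in\mathbb Z),$$ where, under $P^0$, the $\epsilon_k\ge 0$ are i.i.d. with all moments finite, the $e_k$ are i.i.d. Gaussian with mean zero, the sequence $\{e_k\}$ is independent of the sequence $\{\epsilon_k\}$, and the real coefficients $b_j$ satisfy, for some constant $C\neq0$, as $j\to\infty$, $$b_j\sim C j^{d-1}\ \text{ if } d\in(0,\tfrac12),\qquad b_j\sim C a^j\ \text{ for some real } a \text{ with } |a|<1\ \text{ if } d=0.$$ For $n\ge1$ let $$y_n=\frac{\sum_{k=1}^n\tau_k}{n^{1/2+d}}.$$ Then for every fixed integer $p\ge2$, $E^0\{|y_n-E^0(y_n)|^p\}$ is finite and bounded uniformly in $n\ge 1$: $\ \sup_{n\ge1}E^0|y_n-E^0(y_n)|^p<\infty$. -/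

import Mathlib

open MeasureTheory ProbabilityTheory Filter Topology
open scoped NNReal

/-- The moving-average coefficients of the log-volatility process with memory parameter `d`:
`b j ~ C * j ^ (d - 1)` if `0 < d`, and `b j ~ C * a ^ j` with `|a| < 1` if `d = 0`, as `j → ∞`,
where `C ≠ 0`. (For `a = 0` the second condition says that `b j` vanishes for all large `j`.) -/
def LMSDCoeff (d : ℝ) (b : ℕ → ℝ) : Prop :=
  (0 < d → ∃ C : ℝ, C ≠ 0 ∧
    Asymptotics.IsEquivalent atTop b (fun j : ℕ => C * (j : ℝ) ^ (d - 1))) ∧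
  (d = 0 → ∃ C a : ℝ, C ≠ 0 ∧ |a| < 1 ∧
    Asymptotics.IsEquivalent atTop b (fun j : ℕ => C * a ^ j))

/-- `τ` is a Long-Memory Stochastic Duration process under the probability measure `P`, with memory
parameter `d`: `τ k = exp (h k) * ε k` with `h k = ∑_{j ≥ 0} b j * e (k - j)`. -/
structure IsLMSD {Ω : Type*} [MeasurableSpace Ω] (P : Measure Ω) (d : ℝ) (b : ℕ → ℝ)
    (e ε h τ : ℤ → Ω → ℝ) : Prop where
  coeff : LMSDCoeff d b
  /-- the `e k` are i.i.d. centred Gaussian -/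
  measurable_e : ∀ k, Measurable (e k)
  gaussian_e : ∃ v : ℝ≥0, ∀ k, P.map (e k) = gaussianReal 0 v
  indep_e : iIndepFun e P
  /-- the `ε k` are i.i.d., nonnegative, with all moments finite -/
  measurable_ε : ∀ k, Measurable (ε k)
  nonneg_ε : ∀ k, ∀ᵐ ω ∂P, 0 ≤ ε k ω
  identDistrib_ε : ∀ k, IdentDistrib (ε k) (ε 0) P P
  indep_ε : iIndepFun ε P
  moments_ε : ∀ (k : ℤ) (q : ℕ), Integrable (fun ω => |ε k ω| ^ q) P
  /-- the whole sequence `e` is independent of the whole sequence `ε` -/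
  indep_e_ε : IndepFun (fun ω (k : ℤ) => e k ω) (fun ω (k : ℤ) => ε k ω) P
  /-- `h k` is the sum of the series `∑_{j ≥ 0} b j * e (k - j)`, i.e. the limit of its partial
  sums. For independent centred Gaussian terms, convergence in probability, almost sure convergence
  and convergence in mean square are equivalent, with the same limit almost surely. (The series need
  not converge absolutely, so an unconditional sum would be wrong here.) -/
  series_h : ∀ k : ℤ, TendstoInMeasure P
    (fun (N : ℕ) ω => ∑ j ∈ Finset.range N, b j * e (k - (j : ℤ)) ω) atTop (h k)
  duration_eq : ∀ k ω, τ k ω = Real.exp (h k ω) * ε k ω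

/-- The normalized partial sum `y_n = n ^ (-(1/2 + d)) * ∑_{k=1}^n τ k`. -/
noncomputable def normalizedSum {Ω : Type*} (d : ℝ) (τ : ℤ → Ω → ℝ) (n : ℕ) (ω : Ω) : ℝ :=
  (∑ k ∈ Finset.Icc 1 n, τ (k : ℤ) ω) / (n : ℝ) ^ (1 / 2 + d)

/-!
Divided by its mean, `exp (h k)` becomes the Wick exponential `W k`, a product of independent
factors of mean one, one for each innovation. With `μ = E ε`, the centred and rescaled partial sum
is `μ * ∑ (W k - 1) + ∑ W k * (ε k - μ)`. Reveal the innovations one at a time in the first sum,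
and the `ε k` one at a time in the second: every increment is orthogonal to all functions of the
past, so squared `L^{2(m+1)}` norms add up, to within a constant factor, as they do for orthogonal
variables in `L²`. The innovation `e i` contributes `O((∑_{k=1}^n |b (k - i)|)²)`, and these
numbers sum to `O(n ^ (1 + 2 * d))`, while the `ε k` contribute only `O(n)`. The constants do not
depend on how many innovations enter the moving average, so Fatou's lemma carries the bound from
finite truncations to the full series. Finally, replacing an arbitrary centre by the true mean
costs a constant factor.
-/

/-- `f` has finite absolute moments of every order under `P`; measurability is included. These
random variables form an algebra, so no exponent has to be tracked in products. -/
def HasMoments {Ω : Type*} [MeasurableSpace Ω] (f : Ω → ℝ) (P : Measure Ω) : Prop :=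
  ∀ q : ℕ, MemLp f q P

namespace HasMoments

variable {Ω : Type*} [MeasurableSpace Ω] {P : Measure Ω} {f g : Ω → ℝ}

theorem aestronglyMeasurable (hf : HasMoments f P) : AEStronglyMeasurable f P := (hf 0).1

theorem integrable (hf : HasMoments f P) : Integrable f P :=
  memLp_one_iff_integrable.1 (by exact_mod_cast hf 1)

theorem add (hf : HasMoments f P) (hg : HasMoments g P) : HasMoments (fun ω => f ω + g ω) P :=
  fun q => (hf q).add (hg q)

theorem sub (hf : HasMoments f P) (hg : HasMoments g P) : HasMoments (fun ω => f ω - g ω) P :=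
  fun q => (hf q).sub (hg q)

theorem mul (hf : HasMoments f P) (hg : HasMoments g P) : HasMoments (fun ω => f ω * g ω) P := by
  intro q
  have : ENNReal.HolderTriple ((2 * q : ℕ) : ENNReal) ((2 * q : ℕ) : ENNReal) (q : ENNReal) := by
    constructor
    rw [Nat.cast_mul, ENNReal.mul_inv (by simp) (by simp), ← add_mul]
    simp [ENNReal.inv_two_add_inv_two]
  exact (hg (2 * q)).mul' (hf (2 * q))

theorem const_mul (hf : HasMoments f P) (c : ℝ) : HasMoments (fun ω => c * f ω) P :=
  fun q => (hf q).const_mul c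

theorem sum {ι : Type*} (s : Finset ι) {F : ι → Ω → ℝ} (hF : ∀ i ∈ s, HasMoments (F i) P) :
    HasMoments (fun ω => ∑ i ∈ s, F i ω) P :=
  fun q => memLp_finsetSum s fun i hi => hF i hi q

theorem of_integrable_abs_pow (hm : AEStronglyMeasurable f P)
    (h : ∀ q : ℕ, Integrable (fun ω => |f ω| ^ q) P) : HasMoments f P := by
  intro q
  rcases Nat.eq_zero_or_pos q with rfl | hq
  · simpa using hm
  · rw [← integrable_norm_rpow_iff hm (by simpa using hq.ne') (by simp)]
    simpa using h q

variable [IsFiniteMeasure P]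

theorem const (c : ℝ) : HasMoments (fun _ => c) P := fun _ => memLp_const c

theorem pow (hf : HasMoments f P) (n : ℕ) : HasMoments (fun ω => f ω ^ n) P := by
  induction n with
  | zero => simpa using const (P := P) 1
  | succ n ih => simpa [pow_succ] using ih.mul hf

end HasMoments

theorem abs_add_pow_sub_sub_le (n : ℕ) (x y : ℝ) :
    |(x + y) ^ (n + 2) - x ^ (n + 2) - (n + 2) * (x ^ (n + 1) * y)| ≤
      (n + 2).choose 2 * ((|x| + |y|) ^ n * y ^ 2) := by
  induction n with
  | zero => simp [show (x + y) ^ 2 - x ^ 2 - 2 * (x * y) = y ^ 2 by ring]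
  | succ n ih =>
    set r := (x + y) ^ (n + 2) - x ^ (n + 2) - (n + 2) * (x ^ (n + 1) * y)
    have hstep : (x + y) ^ (n + 1 + 2) - x ^ (n + 1 + 2) - ((n + 1 : ℕ) + 2) * (x ^ (n + 1 + 1) * y)
        = (x + y) * r + (n + 2) * (x ^ (n + 1) * y ^ 2) := by
      simp only [r]; push_cast; ring
    have hchoose : ((n + 1 + 2).choose 2 : ℝ) = (n + 2).choose 2 + (n + 2) := by
      have := Nat.choose_succ_succ' (n + 2) 1
      rw [Nat.choose_one_right] at this
      rw [show n + 1 + 2 = n + 2 + 1 by rfl, this]; push_cast; ring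
    calc _ ≤ |x + y| * |r| + (n + 2) * (|x| ^ (n + 1) * y ^ 2) := by
          rw [hstep]
          refine (abs_add_le _ _).trans_eq ?_
          simp only [abs_mul, abs_pow, sq_abs, abs_of_nonneg (show (0 : ℝ) ≤ n + 2 by positivity)]
      _ ≤ (|x| + |y|) * ((n + 2).choose 2 * ((|x| + |y|) ^ n * y ^ 2)) +
          (n + 2) * ((|x| + |y|) ^ (n + 1) * y ^ 2) := by
          gcongr
          · exact abs_add_le x y
          · exact le_add_of_nonneg_right (abs_nonneg y)
      _ = _ := by rw [hchoose]; ring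

theorem add_pow_two_mul_le (k : ℕ) (x y : ℝ) :
    (x + y) ^ (2 * (k + 1)) ≤ x ^ (2 * (k + 1)) + 2 * (k + 1) * (x ^ (2 * k + 1) * y) +
      16 ^ (k + 1) / 4 * (x ^ (2 * k) * y ^ 2 + y ^ (2 * (k + 1))) := by
  have htaylor := (le_abs_self _).trans (abs_add_pow_sub_sub_le (2 * k) x y)
  have hchoose : ((2 * k + 2).choose 2 : ℝ) ≤ 4 ^ (k + 1) := by
    rw [show (4 : ℝ) ^ (k + 1) = 2 ^ (2 * k + 2) by rw [← mul_add_one, pow_mul]; norm_num]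
    exact_mod_cast Nat.choose_le_two_pow _ _
  have hconvex : (|x| + |y|) ^ (2 * k) ≤ 4 ^ k * (x ^ (2 * k) + y ^ (2 * k)) := by
    calc _ ≤ 2 ^ (2 * k - 1) * (|x| ^ (2 * k) + |y| ^ (2 * k)) :=
          add_pow_le (abs_nonneg x) (abs_nonneg y) _
      _ ≤ 2 ^ (2 * k) * (|x| ^ (2 * k) + |y| ^ (2 * k)) := by
          gcongr <;> [norm_num; omega]
      _ = _ := by rw [(even_two_mul k).pow_abs, (even_two_mul k).pow_abs, pow_mul]; norm_num
  have hremainder : ((2 * k + 2).choose 2 : ℝ) * ((|x| + |y|) ^ (2 * k) * y ^ 2) ≤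
      16 ^ (k + 1) / 4 * (x ^ (2 * k) * y ^ 2 + y ^ (2 * (k + 1))) := by
    calc _ ≤ 4 ^ (k + 1) * (4 ^ k * (x ^ (2 * k) + y ^ (2 * k)) * y ^ 2) := by gcongr
      _ = _ := by rw [show (16 : ℝ) = 4 * 4 by norm_num, mul_pow]; ring
  push_cast at htaylor
  rw [show 2 * (k + 1) = 2 * k + 2 by ring] at hremainder ⊢
  linarith

theorem sum_mul_pow_succ_le {ι : Type*} (s : Finset ι) {w u : ι → ℝ} (hw : ∀ i, 0 ≤ w i)
    (hu : ∀ i, 0 ≤ u i) (q : ℕ) :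
    (∑ i ∈ s, w i * u i) ^ (q + 1) ≤ (∑ i ∈ s, w i) ^ q * ∑ i ∈ s, w i * u i ^ (q + 1) := by
  have hq : (1 : ℝ) ≤ (q + 1 : ℕ) := by simp
  have hsum : 0 ≤ ∑ i ∈ s, w i * u i := Finset.sum_nonneg fun i _ => mul_nonneg (hw i) (hu i)
  have hW : 0 ≤ ∑ i ∈ s, w i := Finset.sum_nonneg fun i _ => hw i
  have hWu : 0 ≤ ∑ i ∈ s, w i * u i ^ (q + 1) :=
    Finset.sum_nonneg fun i _ => mul_nonneg (hw i) (pow_nonneg (hu i) _)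
  have hexp : (1 - ((q + 1 : ℕ) : ℝ)⁻¹) * (q + 1 : ℕ) = q := by
    push_cast; field_simp; ring
  have hholder := pow_le_pow_left₀ hsum
    (Real.inner_le_weight_mul_Lp_of_nonneg s hq w u hw hu) (q + 1)
  simp only [Real.rpow_natCast] at hholder
  rwa [mul_pow, Real.rpow_inv_natCast_pow hWu (by omega),
    ← Real.rpow_mul_natCast hW, hexp, Real.rpow_natCast] at hholder

section MomentInequalities

variable {Ω : Type*} [MeasurableSpace Ω] {P : Measure Ω}

theorem integral_add_pow_two_mul_le [IsFiniteMeasure P] {X Y : Ω → ℝ}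
    (hX : HasMoments X P) (hY : HasMoments Y P) (q : ℕ) :
    ∫ ω, (X ω + Y ω) ^ (2 * q) ∂P ≤
      2 ^ (2 * q - 1) * (∫ ω, X ω ^ (2 * q) ∂P + ∫ ω, Y ω ^ (2 * q) ∂P) := by
  have hXq := (hX.pow (2 * q)).integrable
  have hYq := (hY.pow (2 * q)).integrable
  rw [← integral_add hXq hYq, ← integral_const_mul]
  exact integral_mono ((hX.add hY).pow _).integrable ((hXq.add hYq).const_mul _)
    fun ω => (even_two_mul q).add_pow_le

theorem integral_pow_mul_le {f g : Ω → ℝ} (k : ℕ) (hf : Integrable (fun ω => f ω ^ (k + 1)) P)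
    (hg : Integrable (fun ω => g ω ^ (k + 1)) P) (hf0 : ∀ ω, 0 ≤ f ω) (hg0 : ∀ ω, 0 ≤ g ω)
    {V v : ℝ} (hV : 0 ≤ V) (hv : 0 ≤ v) (hfV : ∫ ω, f ω ^ (k + 1) ∂P ≤ V ^ (k + 1))
    (hgv : ∫ ω, g ω ^ (k + 1) ∂P ≤ v ^ (k + 1)) :
    ∫ ω, f ω ^ k * g ω ∂P ≤ V ^ k * v := by
  have hk : ((k + 1 : ℕ) : ℝ) ≠ 0 := by positivity
  set r : ℝ := ((k + 1 : ℕ) : ℝ)⁻¹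
  have hr : 0 ≤ r := by positivity
  have hroot : ∀ {x : ℝ}, 0 ≤ x → ENNReal.ofReal (x ^ (k + 1)) ^ r = ENNReal.ofReal x := by
    intro x hx
    rw [ENNReal.ofReal_rpow_of_nonneg (by positivity) hr, Real.pow_rpow_inv_natCast hx (by omega)]
  have hroot' : ∀ {x : ℝ}, 0 ≤ x →
      ENNReal.ofReal (x ^ (k + 1)) ^ (k * r) = ENNReal.ofReal (x ^ k) := by
    intro x hx
    rw [mul_comm, ENNReal.rpow_mul, hroot hx, ENNReal.rpow_natCast, ENNReal.ofReal_pow hx]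
  have hlint : ∀ {f : Ω → ℝ} {V : ℝ}, Integrable (fun ω => f ω ^ (k + 1)) P → (∀ ω, 0 ≤ f ω) →
      ∫ ω, f ω ^ (k + 1) ∂P ≤ V ^ (k + 1) →
      ∫⁻ ω, ENNReal.ofReal (f ω ^ (k + 1)) ∂P ≤ ENNReal.ofReal (V ^ (k + 1)) := by
    intro f V hf hf0 hfV
    rw [← ofReal_integral_eq_lintegral_ofReal hf (ae_of_all _ fun ω => pow_nonneg (hf0 ω) _)]
    exact ENNReal.ofReal_le_ofReal hfV
  have hholder := ENNReal.lintegral_mul_norm_pow_le hf.1.aemeasurable.ennreal_ofReal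
    hg.1.aemeasurable.ennreal_ofReal (mul_nonneg k.cast_nonneg hr) hr
    (by simp only [r]; push_cast at hk ⊢; field_simp)
  simp only [hroot (hg0 _), hroot' (hf0 _)] at hholder
  calc ∫ ω, f ω ^ k * g ω ∂P ≤ (∫⁻ ω, ENNReal.ofReal ‖f ω ^ k * g ω‖ ∂P).toReal :=
        (Real.le_norm_self _).trans (norm_integral_le_lintegral_norm _)
    _ ≤ (ENNReal.ofReal (V ^ k) * ENNReal.ofReal v).toReal := by
        refine ENNReal.toReal_mono (by finiteness) ?_
        simp only [Real.norm_of_nonneg (mul_nonneg (pow_nonneg (hf0 _) k) (hg0 _)),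
          ENNReal.ofReal_mul (pow_nonneg (hf0 _) k)]
        refine hholder.trans ?_
        rw [← hroot hv, ← hroot' hV]
        gcongr <;> [exact hlint hf hf0 hfV; exact hlint hg hg0 hgv]
    _ = V ^ k * v := by
        rw [← ENNReal.ofReal_mul (by positivity), ENNReal.toReal_ofReal (by positivity)]

theorem add_mul_add_pow_le_add_pow (k : ℕ) {V w : ℝ} (hV : 0 ≤ V) (hw : 0 ≤ w) :
    V ^ (k + 1) + w / 2 * (V ^ k + w ^ k) ≤ (V + w) ^ (k + 1) := by
  have hVw : V ^ k ≤ (V + w) ^ k := by gcongr; linarith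
  have hwV : w ^ k ≤ (V + w) ^ k := by gcongr; linarith
  rw [pow_succ, pow_succ]
  nlinarith [mul_le_mul_of_nonneg_left hVw hV, mul_le_mul_of_nonneg_left hVw hw,
    mul_le_mul_of_nonneg_left hwV hw]

/-- The second moment of a sum of orthogonal variables is additive; for `L^{2(k+1)}` norms this
survives, up to a constant on the new term, if only the linear Taylor term vanishes. -/
theorem integral_add_pow_le [IsFiniteMeasure P] (k : ℕ) {X Y : Ω → ℝ} (hX : HasMoments X P)
    (hY : HasMoments Y P) (hXY : ∫ ω, X ω ^ (2 * k + 1) * Y ω ∂P = 0) {V v : ℝ} (hV : 0 ≤ V)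
    (hv : 0 ≤ v) (hXV : ∫ ω, X ω ^ (2 * (k + 1)) ∂P ≤ V ^ (k + 1))
    (hYv : ∫ ω, Y ω ^ (2 * (k + 1)) ∂P ≤ v ^ (k + 1)) :
    ∫ ω, (X ω + Y ω) ^ (2 * (k + 1)) ∂P ≤ (V + 16 ^ (k + 1) * v) ^ (k + 1) := by
  have hcross : ∫ ω, X ω ^ (2 * k) * Y ω ^ 2 ∂P ≤ V ^ k * v := by
    simp only [pow_mul] at hXV hYv ⊢
    refine integral_pow_mul_le k ?_ ?_ (fun _ => sq_nonneg _) (fun _ => sq_nonneg _) hV hv hXV hYv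
    · exact ((hX.pow 2).pow (k + 1)).integrable
    · exact ((hY.pow 2).pow (k + 1)).integrable
  have hX2 := hX.pow (2 * (k + 1))
  have hY2 := hY.pow (2 * (k + 1))
  have hlin := ((hX.pow (2 * k + 1)).mul hY).const_mul (2 * (k + 1 : ℝ))
  have hquad := (hX.pow (2 * k)).mul (hY.pow 2)
  have hrem := (hquad.add hY2).const_mul ((16 : ℝ) ^ (k + 1) / 4)
  calc ∫ ω, (X ω + Y ω) ^ (2 * (k + 1)) ∂P
      ≤ ∫ ω, (X ω ^ (2 * (k + 1)) + 2 * (k + 1) * (X ω ^ (2 * k + 1) * Y ω) +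
          16 ^ (k + 1) / 4 * (X ω ^ (2 * k) * Y ω ^ 2 + Y ω ^ (2 * (k + 1)))) ∂P :=
        integral_mono ((hX.add hY).pow _).integrable ((hX2.add hlin).add hrem).integrable
          fun ω => add_pow_two_mul_le k (X ω) (Y ω)
    _ = ∫ ω, X ω ^ (2 * (k + 1)) ∂P + 16 ^ (k + 1) / 4 *
          (∫ ω, X ω ^ (2 * k) * Y ω ^ 2 ∂P + ∫ ω, Y ω ^ (2 * (k + 1)) ∂P) := by
        rw [integral_add (hX2.add hlin).integrable hrem.integrable,
          integral_add hX2.integrable hlin.integrable, integral_const_mul, hXY, integral_const_mul,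
          integral_add hquad.integrable hY2.integrable, mul_zero, add_zero]
    _ ≤ V ^ (k + 1) + 16 ^ (k + 1) / 4 * (V ^ k * v + v ^ (k + 1)) := by gcongr
    _ ≤ V ^ (k + 1) + 16 ^ (k + 1) * v / 2 * (V ^ k + (16 ^ (k + 1) * v) ^ k) := by
        have : v ^ k ≤ (16 ^ (k + 1) * v) ^ k := by
          gcongr
          exact le_mul_of_one_le_left hv (one_le_pow₀ (by norm_num))
        rw [pow_succ v]
        have : 0 ≤ (16 : ℝ) ^ (k + 1) * v := by positivity
        nlinarith [pow_nonneg hV k, pow_nonneg hv k]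
    _ ≤ _ := add_mul_add_pow_le_add_pow k hV (by positivity)

theorem integral_pow_le_of_orthogonal_increments [IsFiniteMeasure P] {ι : Type*} [DecidableEq ι]
    {X : Finset ι → Ω → ℝ} {a : ι → ℝ} (k : ℕ) (hX : ∀ I, HasMoments (X I) P)
    (hempty : ∀ ω, X ∅ ω = 0) (ha : ∀ i, 0 ≤ a i)
    (horth : ∀ I, ∀ i ∉ I, ∫ ω, X I ω ^ (2 * k + 1) * (X (insert i I) ω - X I ω) ∂P = 0)
    (hincr : ∀ I, ∀ i ∉ I,
      ∫ ω, (X (insert i I) ω - X I ω) ^ (2 * (k + 1)) ∂P ≤ a i ^ (k + 1)) (I : Finset ι) :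
    ∫ ω, X I ω ^ (2 * (k + 1)) ∂P ≤ (16 ^ (k + 1) * ∑ i ∈ I, a i) ^ (k + 1) := by
  induction I using Finset.induction_on with
  | empty => simp [hempty]
  | insert i I hi ih =>
    have hstep := integral_add_pow_le k (hX I) ((hX (insert i I)).sub (hX I)) (horth I i hi)
      (mul_nonneg (by positivity) (Finset.sum_nonneg fun i _ => ha i)) (ha i) ih (hincr I i hi)
    simpa only [add_sub_cancel, Finset.sum_insert hi, mul_add, add_comm] using hstep

theorem integral_sum_mul_pow_le [IsFiniteMeasure P] {ι : Type*} (s : Finset ι) {w : ι → ℝ}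
    {U : ι → Ω → ℝ} {D : ℝ} (q : ℕ) (hw : ∀ i, 0 ≤ w i) (hU : ∀ i, HasMoments (U i) P)
    (hU0 : ∀ i ω, 0 ≤ U i ω) (hD : ∀ i, ∫ ω, U i ω ^ (q + 1) ∂P ≤ D) :
    ∫ ω, (∑ i ∈ s, w i * U i ω) ^ (q + 1) ∂P ≤ (∑ i ∈ s, w i) ^ (q + 1) * D := by
  have hterm := fun i => ((hU i).pow (q + 1)).const_mul (w i)
  calc ∫ ω, (∑ i ∈ s, w i * U i ω) ^ (q + 1) ∂P
      ≤ ∫ ω, (∑ i ∈ s, w i) ^ q * ∑ i ∈ s, w i * U i ω ^ (q + 1) ∂P :=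
        integral_mono
          ((HasMoments.sum s fun i _ => (hU i).const_mul (w i)).pow (q + 1)).integrable
          ((HasMoments.sum s fun i _ => hterm i).const_mul _).integrable
          fun ω => sum_mul_pow_succ_le s hw (fun i => hU0 i ω) q
    _ = (∑ i ∈ s, w i) ^ q * ∑ i ∈ s, w i * ∫ ω, U i ω ^ (q + 1) ∂P := by
        rw [integral_const_mul, integral_finsetSum s fun i _ => (hterm i).integrable]
        simp only [integral_const_mul]
    _ ≤ (∑ i ∈ s, w i) ^ q * ∑ i ∈ s, w i * D := by
        have := Finset.sum_nonneg fun i (_ : i ∈ s) => hw i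
        gcongr with i
        exacts [hw i, hD i]
    _ = _ := by rw [← Finset.sum_mul, pow_succ, mul_assoc]

end MomentInequalities

section PowerSums

theorem mul_add_one_rpow_sub_one_le {α s : ℝ} (hα0 : 0 ≤ α) (hα1 : α ≤ 1) (hs : 0 ≤ s) :
    α * (s + 1) ^ (α - 1) ≤ (s + 1) ^ α - s ^ α := by
  have hs1 : 0 < s + 1 := by linarith
  have hinv : (s + 1)⁻¹ ≤ 1 := inv_le_one_of_one_le₀ (by linarith)
  have hbernoulli : (1 - (s + 1)⁻¹) ^ α ≤ 1 - α * (s + 1)⁻¹ := by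
    simpa [← sub_eq_add_neg] using
      rpow_one_add_le_one_add_mul_self (s := -(s + 1)⁻¹) (by linarith) hα0 hα1
  have hfactor : s ^ α = (s + 1) ^ α * (1 - (s + 1)⁻¹) ^ α := by
    rw [← Real.mul_rpow hs1.le (by linarith)]
    congr 1
    field_simp
    ring
  rw [hfactor, Real.rpow_sub_one hs1.ne', div_eq_mul_inv]
  linarith [mul_le_mul_of_nonneg_left hbernoulli (Real.rpow_nonneg hs1.le α)]

theorem sum_range_rpow_le {d : ℝ} (hd0 : 0 < d) (hd1 : d ≤ 1) (N : ℕ) :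
    ∑ j ∈ Finset.range N, ((j : ℝ) + 1) ^ (d - 1) ≤ (N : ℝ) ^ d / d := by
  rw [le_div_iff₀ hd0, Finset.sum_mul]
  calc ∑ j ∈ Finset.range N, ((j : ℝ) + 1) ^ (d - 1) * d
      ≤ ∑ j ∈ Finset.range N, (((j + 1 : ℕ) : ℝ) ^ d - (j : ℝ) ^ d) := by
        refine Finset.sum_le_sum fun j _ => ?_
        rw [mul_comm, Nat.cast_add_one]
        exact mul_add_one_rpow_sub_one_le hd0.le hd1 j.cast_nonneg
    _ = (N : ℝ) ^ d := by
        rw [Finset.sum_range_sub fun j : ℕ => (j : ℝ) ^ d, Nat.cast_zero, Real.zero_rpow hd0.ne',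
          sub_zero]

theorem rpow_neg_sub_one_le {α s : ℝ} (hα0 : 0 < α) (hα1 : α ≤ 1) (hs : 1 ≤ s) :
    s ^ (-α - 1) ≤ 2 / α * (s ^ (-α) - (s + 1) ^ (-α)) := by
  have hs0 : 0 < s := by linarith
  have hs1 : 0 < s + 1 := by linarith
  have hincr := mul_add_one_rpow_sub_one_le hα0.le hα1 hs0.le
  have : 0 < s ^ α := by positivity
  have : 0 < (s + 1) ^ α := by positivity
  rw [Real.rpow_sub_one hs1.ne'] at hincr
  rw [Real.rpow_sub_one hs0.ne', Real.rpow_neg hs0.le, Real.rpow_neg hs1.le]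
  calc (s ^ α)⁻¹ / s ≤ (s ^ α)⁻¹ * (2 / (s + 1)) := by
        rw [div_eq_mul_inv]
        gcongr
        rw [inv_eq_one_div, div_le_div_iff₀ hs0 hs1]
        linarith
    _ = 2 / α * ((s ^ α)⁻¹ * ((s + 1) ^ α)⁻¹ * (α * ((s + 1) ^ α / (s + 1)))) := by field_simp
    _ ≤ 2 / α * ((s ^ α)⁻¹ * ((s + 1) ^ α)⁻¹ * ((s + 1) ^ α - s ^ α)) := by gcongr
    _ = _ := by field_simp

theorem sum_Ico_rpow_neg_sub_one_le {α : ℝ} (hα0 : 0 < α) (hα1 : α ≤ 1) {n N : ℕ} (hn : 0 < n)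
    (hN : n ≤ N) : ∑ s ∈ Finset.Ico n N, (s : ℝ) ^ (-α - 1) ≤ 2 / α * (n : ℝ) ^ (-α) := by
  calc ∑ s ∈ Finset.Ico n N, (s : ℝ) ^ (-α - 1)
      ≤ ∑ s ∈ Finset.Ico n N, 2 / α * ((s : ℝ) ^ (-α) - ((s + 1 : ℕ) : ℝ) ^ (-α)) := by
        refine Finset.sum_le_sum fun s hs => ?_
        rw [Nat.cast_add_one]
        exact rpow_neg_sub_one_le hα0 hα1
          (by exact_mod_cast hn.trans_le (Finset.mem_Ico.1 hs).1)
    _ = 2 / α * ((n : ℝ) ^ (-α) - (N : ℝ) ^ (-α)) := by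
        rw [← Finset.mul_sum, ← neg_sub, ← Finset.sum_Ico_sub (fun s : ℕ => (s : ℝ) ^ (-α)) hN,
          ← Finset.sum_neg_distrib]
        simp only [neg_sub]
    _ ≤ 2 / α * (n : ℝ) ^ (-α) := by
        gcongr
        exact sub_le_self _ (by positivity)

theorem sum_rpow_neg_sub_one_le {α : ℝ} (hα0 : 0 < α) (hα1 : α ≤ 1) {n : ℕ} (hn : 0 < n)
    {T : Finset ℕ} (hT : ∀ s ∈ T, n ≤ s) :
    ∑ s ∈ T, (s : ℝ) ^ (-α - 1) ≤ 2 / α * (n : ℝ) ^ (-α) := by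
  have hsub : T ⊆ Finset.Ico n (n + T.sup id + 1) := by
    intro s hs
    have : s ≤ T.sup id := Finset.le_sup (f := id) hs
    exact Finset.mem_Ico.2 ⟨hT s hs, by omega⟩
  exact (Finset.sum_le_sum_of_subset_of_nonneg hsub fun _ _ _ => by positivity).trans
    (sum_Ico_rpow_neg_sub_one_le hα0 hα1 hn (by omega))

end PowerSums

section Coefficients

/-- The sequence `b` extended by zero to negative indices. Since `h k = ∑ j, b j * e (k - j)`, the
coefficient of the innovation `e i` in `h k` is `causal b (k - i)`, also for `i > k`. -/
noncomputable def causal (b : ℕ → ℝ) : ℤ → ℝ := Function.extend ((↑) : ℕ → ℤ) b 0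

theorem causal_natCast (b : ℕ → ℝ) (j : ℕ) : causal b j = b j :=
  Nat.cast_injective.extend_apply b 0 j

theorem causal_of_neg (b : ℕ → ℝ) {j : ℤ} (hj : j < 0) : causal b j = 0 :=
  Function.extend_apply' b (0 : ℤ → ℝ) j (by rintro ⟨m, rfl⟩; omega)

theorem apply_causal {φ : ℝ → ℝ} (hφ : φ 0 = 0) (b : ℕ → ℝ) (j : ℤ) :
    φ (causal b j) = causal (φ ∘ b) j := by
  rcases lt_or_ge j 0 with hj | hj
  · simp only [causal_of_neg _ hj, hφ]
  · lift j to ℕ using hj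
    simp only [causal_natCast, Function.comp_apply]

theorem abs_causal (b : ℕ → ℝ) (j : ℤ) : |causal b j| = causal (fun m => |b m|) j :=
  apply_causal (φ := abs) abs_zero b j

theorem causal_nonneg {b : ℕ → ℝ} (hb : ∀ j, 0 ≤ b j) (j : ℤ) : 0 ≤ causal b j := by
  rcases lt_or_ge j 0 with hj | hj
  · rw [causal_of_neg _ hj]
  · lift j to ℕ using hj
    rw [causal_natCast]
    exact hb j

theorem sum_causal_comp_le_tsum {ι : Type*} {b : ℕ → ℝ} (hb : Summable b) (hb0 : ∀ j, 0 ≤ b j)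
    (s : Finset ι) {g : ι → ℤ} (hg : g.Injective) : ∑ x ∈ s, causal b (g x) ≤ ∑' j, b j := by
  have hsum : Summable (causal b) := (hasSum_extend_zero Nat.cast_injective).2 hb.hasSum |>.summable
  have h0 := causal_nonneg hb0
  calc ∑ x ∈ s, causal b (g x) ≤ ∑' x, causal b (g x) :=
        (hsum.comp_injective hg).sum_le_tsum s fun x _ => h0 (g x)
    _ ≤ ∑' j, causal b j := tsum_comp_le_tsum_of_inj hsum h0 hg
    _ = ∑' j, b j := tsum_extend_zero Nat.cast_injective b

theorem sum_causal_sq_le_tsum {b : ℕ → ℝ} (hb : Summable fun j => b j ^ 2) (k : ℤ)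
    (I : Finset ℤ) : ∑ i ∈ I, causal b (k - i) ^ 2 ≤ ∑' j, b j ^ 2 := by
  simp only [apply_causal (φ := fun x => x ^ 2) (zero_pow two_ne_zero)]
  exact sum_causal_comp_le_tsum hb (fun _ => sq_nonneg _) I sub_right_injective

theorem sum_Icc_causal_eq_sum_range {M : Type*} [AddCommMonoid M] (b : ℕ → ℝ) {n k : ℕ}
    (hk : k ≤ n) (L : ℕ) {f : ℝ → ℤ → M} (hf : ∀ i, f 0 i = 0) :
    ∑ i ∈ Finset.Icc (-(L : ℤ)) n, f (causal b (k - i)) i =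
      ∑ j ∈ Finset.range (k + L + 1), f (b j) (k - j) := by
  symm
  refine Finset.sum_of_injOn (fun j : ℕ => (k : ℤ) - j)
    (sub_right_injective.comp Nat.cast_injective).injOn ?_ ?_ ?_
  · intro j hj
    simp only [Finset.coe_range, Set.mem_Iio] at hj
    simp only [Finset.coe_Icc, Set.mem_Icc]
    omega
  · intro i hi hrange
    rw [Finset.mem_Icc] at hi
    have hlt : (k : ℤ) - i < 0 := by
      by_contra! hle
      refine hrange ⟨((k : ℤ) - i).toNat, ?_, ?_⟩
      · simp only [Finset.coe_range, Set.mem_Iio]; omega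
      · simp only; omega
    rw [causal_of_neg b hlt, hf]
  · intro j _
    rw [sub_sub_cancel, causal_natCast]

/-- The total absolute coefficient of the innovation `e i` in `h 1 + ⋯ + h n`. -/
noncomputable def innovationWeight (b : ℕ → ℝ) (n : ℕ) (i : ℤ) : ℝ :=
  ∑ k ∈ Finset.Icc 1 n, |causal b (k - i)|

/-- The moving average with coefficients `b` has memory at most `d`: the squared innovation weights
of `h 1 + ⋯ + h n` add up to `O(n ^ (1 + 2 * d))`. -/
def HasMemoryAtMost (d : ℝ) (b : ℕ → ℝ) : Prop :=
  ∃ C : ℝ, ∀ n : ℕ, 1 ≤ n → ∀ I : Finset ℤ,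
    ∑ i ∈ I, innovationWeight b n i ^ 2 ≤ C * (n : ℝ) ^ (1 + 2 * d)

theorem HasMemoryAtMost.summable_sq {d : ℝ} {b : ℕ → ℝ} (hb : HasMemoryAtMost d b) :
    Summable fun j => b j ^ 2 := by
  obtain ⟨C, hC⟩ := hb
  refine summable_of_sum_le (c := C) (fun _ => sq_nonneg _) fun s => ?_
  have hinj : Function.Injective fun j : ℕ => (1 : ℤ) - j :=
    sub_right_injective.comp Nat.cast_injective
  simpa [innovationWeight, causal_natCast] using hC 1 le_rfl (s.map ⟨_, hinj⟩)

theorem innovationWeight_nonneg (b : ℕ → ℝ) (n : ℕ) (i : ℤ) : 0 ≤ innovationWeight b n i :=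
  Finset.sum_nonneg fun _ _ => abs_nonneg _

theorem hasMemoryAtMost_zero_of_summable {b : ℕ → ℝ} (hb : Summable fun j => |b j|) :
    HasMemoryAtMost 0 b := by
  set B := ∑' j, |b j|
  have hweight : ∀ n i, innovationWeight b n i ≤ B := by
    intro n i
    simp only [innovationWeight, abs_causal]
    exact sum_causal_comp_le_tsum hb (fun _ => abs_nonneg _) _
      (sub_left_injective.comp Nat.cast_injective)
  refine ⟨B ^ 2, fun n _ I => ?_⟩
  calc ∑ i ∈ I, innovationWeight b n i ^ 2 ≤ ∑ i ∈ I, B * innovationWeight b n i := by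
        gcongr with i
        rw [sq]
        exact mul_le_mul_of_nonneg_right (hweight n i) (innovationWeight_nonneg b n i)
    _ = B * ∑ k ∈ Finset.Icc 1 n, ∑ i ∈ I, |causal b (k - i)| := by
        simp only [innovationWeight, ← Finset.mul_sum]
        rw [Finset.sum_comm]
    _ ≤ B * ∑ _k ∈ Finset.Icc 1 n, B := by
        refine mul_le_mul_of_nonneg_left (Finset.sum_le_sum fun k _ => ?_)
          (tsum_nonneg fun _ => abs_nonneg _)
        simp only [abs_causal]
        exact sum_causal_comp_le_tsum hb (fun _ => abs_nonneg _) _ sub_right_injective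
    _ = B ^ 2 * (n : ℝ) ^ (1 + 2 * (0 : ℝ)) := by simp; ring

section PowerLaw

variable {b : ℕ → ℝ} {d c : ℝ} {n : ℕ}

theorem innovationWeight_eq_zero {i : ℤ} (hi : n < i) : innovationWeight b n i = 0 := by
  refine Finset.sum_eq_zero fun k hk => ?_
  rw [Finset.mem_Icc] at hk
  rw [causal_of_neg b (by omega), abs_zero]

theorem innovationWeight_le_sum_range {m : ℕ} {i : ℤ} (hi : -(m : ℤ) < i) :
    innovationWeight b n i ≤ ∑ j ∈ Finset.range (n + m), |b j| := by
  -- The innovation `e i` only sees the coefficients up to lag `n - i`, so `b` may be truncated.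
  set b' : ℕ → ℝ := fun j => if j ∈ Finset.range (n + m) then |b j| else 0
  have hsum : Summable b' :=
    summable_of_ne_finset_zero (s := Finset.range (n + m)) fun j hj => if_neg hj
  have hb' : ∀ j, 0 ≤ b' j := fun j => by simp only [b']; split_ifs <;> simp
  calc innovationWeight b n i = ∑ k ∈ Finset.Icc 1 n, causal b' (k - i) := by
        refine Finset.sum_congr rfl fun k hk => ?_
        rw [Finset.mem_Icc] at hk
        rcases lt_or_ge ((k : ℤ) - i) 0 with hj | hj
        · rw [causal_of_neg _ hj, causal_of_neg _ hj, abs_zero]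
        · obtain ⟨j, hj⟩ := Int.eq_ofNat_of_zero_le hj
          rw [hj, causal_natCast, causal_natCast]
          exact (if_pos (Finset.mem_range.2 (by omega))).symm
    _ ≤ ∑' j, b' j :=
        sum_causal_comp_le_tsum hsum hb' _ (sub_left_injective.comp Nat.cast_injective)
    _ = ∑ j ∈ Finset.range (n + m), |b j| := by
        rw [tsum_eq_sum fun j hj => if_neg hj]
        exact Finset.sum_congr rfl fun j hj => if_pos hj

theorem innovationWeight_le_of_neg_lt (hd0 : 0 < d) (hd1 : d ≤ 1) (hc : 0 ≤ c)
    (hb : ∀ j : ℕ, |b j| ≤ c * ((j : ℝ) + 1) ^ (d - 1)) {i : ℤ} (hi : -(n : ℤ) < i) :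
    innovationWeight b n i ≤ c * 2 ^ d / d * (n : ℝ) ^ d := by
  calc innovationWeight b n i ≤ ∑ j ∈ Finset.range (n + n), |b j| :=
        innovationWeight_le_sum_range hi
    _ ≤ ∑ j ∈ Finset.range (n + n), c * ((j : ℝ) + 1) ^ (d - 1) :=
        Finset.sum_le_sum fun j _ => hb j
    _ ≤ c * (((n + n : ℕ) : ℝ) ^ d / d) := by
        rw [← Finset.mul_sum]
        exact mul_le_mul_of_nonneg_left (sum_range_rpow_le hd0 hd1 _) hc
    _ = _ := by
        push_cast
        rw [← two_mul, Real.mul_rpow two_pos.le n.cast_nonneg]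
        ring

theorem innovationWeight_neg_le (hd1 : d ≤ 1) (hc : 0 ≤ c)
    (hb : ∀ j : ℕ, |b j| ≤ c * ((j : ℝ) + 1) ^ (d - 1)) {s : ℕ} (hs : 0 < s) :
    innovationWeight b n (-s) ≤ n * (c * (s : ℝ) ^ (d - 1)) := by
  calc innovationWeight b n (-s) ≤ ∑ _k ∈ Finset.Icc 1 n, c * (s : ℝ) ^ (d - 1) := by
        refine Finset.sum_le_sum fun k _ => ?_
        rw [sub_neg_eq_add, ← Nat.cast_add, causal_natCast]
        refine (hb _).trans (mul_le_mul_of_nonneg_left ?_ hc)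
        refine Real.rpow_le_rpow_of_nonpos (by positivity) ?_ (by linarith)
        exact_mod_cast (by omega : s ≤ k + s + 1)
    _ = _ := by simp

theorem sum_sq_innovationWeight_recent_le (hd0 : 0 < d) (hd1 : d ≤ 1) (hc : 0 ≤ c)
    (hb : ∀ j : ℕ, |b j| ≤ c * ((j : ℝ) + 1) ^ (d - 1)) (hn : 0 < n) (I : Finset ℤ) :
    ∑ i ∈ I with -(n : ℤ) < i, innovationWeight b n i ^ 2 ≤
      2 * (c * 2 ^ d / d) ^ 2 * (n : ℝ) ^ (1 + 2 * d) := by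
  calc ∑ i ∈ I with -(n : ℤ) < i, innovationWeight b n i ^ 2
      ≤ ∑ i ∈ Finset.Ioc (-(n : ℤ)) n, innovationWeight b n i ^ 2 := by
        rw [← Finset.sum_filter_ne_zero]
        refine Finset.sum_le_sum_of_subset_of_nonneg (fun i hi => ?_) fun _ _ _ => sq_nonneg _
        simp only [Finset.mem_filter] at hi
        refine Finset.mem_Ioc.2 ⟨hi.1.2, not_lt.1 fun hlt => hi.2 ?_⟩
        rw [innovationWeight_eq_zero hlt, zero_pow two_ne_zero]
    _ ≤ ∑ i ∈ Finset.Ioc (-(n : ℤ)) n, (c * 2 ^ d / d * (n : ℝ) ^ d) ^ 2 := by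
        gcongr with i hi
        · exact innovationWeight_nonneg b n i
        · exact innovationWeight_le_of_neg_lt hd0 hd1 hc hb (Finset.mem_Ioc.1 hi).1
    _ = 2 * n * (c * 2 ^ d / d * (n : ℝ) ^ d) ^ 2 := by
        rw [Finset.sum_const, Int.card_Ioc, show ((n : ℤ) - -n).toNat = 2 * n by omega,
          nsmul_eq_mul]
        push_cast
        rfl
    _ = _ := by
        have : (0 : ℝ) < n := by exact_mod_cast hn
        rw [Real.rpow_add this, Real.rpow_one, two_mul d, Real.rpow_add this]
        ring

theorem sum_sq_innovationWeight_distant_le (hd0 : 0 ≤ d) (hd : d < 1 / 2) (hc : 0 ≤ c)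
    (hb : ∀ j : ℕ, |b j| ≤ c * ((j : ℝ) + 1) ^ (d - 1)) (hn : 0 < n) (I : Finset ℤ) :
    ∑ i ∈ I with ¬ -(n : ℤ) < i, innovationWeight b n i ^ 2 ≤
      c ^ 2 * (2 / (1 - 2 * d)) * (n : ℝ) ^ (1 + 2 * d) := by
  set T : Finset ℕ := (I.filter fun i => ¬ -(n : ℤ) < i).image fun i => (-i).toNat
  have hT : ∀ s ∈ T, n ≤ s := by
    intro s hs
    obtain ⟨i, hi, rfl⟩ := Finset.mem_image.1 hs
    rw [Finset.mem_filter] at hi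
    omega
  have hn0 : (0 : ℝ) < n := by exact_mod_cast hn
  calc ∑ i ∈ I with ¬ -(n : ℤ) < i, innovationWeight b n i ^ 2
      = ∑ s ∈ T, innovationWeight b n (-s) ^ 2 := by
        rw [Finset.sum_image]
        · refine Finset.sum_congr rfl fun i hi => ?_
          rw [Finset.mem_filter] at hi
          rw [Int.toNat_of_nonneg (by omega), neg_neg]
        · intro i hi j hj hij
          simp only [Finset.coe_filter, Set.mem_ofPred_eq] at hi hj
          simp only at hij
          omega
    _ ≤ ∑ s ∈ T, (n * c) ^ 2 * (s : ℝ) ^ (-(1 - 2 * d) - 1) := by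
        refine Finset.sum_le_sum fun s hs => ?_
        have hs0 : 0 < s := hn.trans_le (hT s hs)
        refine (pow_le_pow_left₀ (innovationWeight_nonneg b n _)
          (innovationWeight_neg_le (by linarith) hc hb hs0) 2).trans_eq ?_
        have : (0 : ℝ) < s := by exact_mod_cast hs0
        rw [show -(1 - 2 * d) - 1 = (d - 1) + (d - 1) by ring, Real.rpow_add this]
        ring
    _ ≤ (n * c) ^ 2 * (2 / (1 - 2 * d) * (n : ℝ) ^ (-(1 - 2 * d))) := by
        rw [← Finset.mul_sum]
        gcongr
        exact sum_rpow_neg_sub_one_le (by linarith) (by linarith) hn hT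
    _ = _ := by
        rw [show 1 + 2 * d = 2 + -(1 - 2 * d) by ring, Real.rpow_add hn0 2, Real.rpow_two]
        ring

theorem hasMemoryAtMost_of_abs_le_rpow (hd0 : 0 < d) (hd : d < 1 / 2) (hc : 0 ≤ c)
    (hb : ∀ j : ℕ, |b j| ≤ c * ((j : ℝ) + 1) ^ (d - 1)) : HasMemoryAtMost d b := by
  refine ⟨2 * (c * 2 ^ d / d) ^ 2 + c ^ 2 * (2 / (1 - 2 * d)), fun n hn I => ?_⟩
  rw [add_mul, ← Finset.sum_filter_add_sum_filter_not I fun i => -(n : ℤ) < i]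
  exact add_le_add (sum_sq_innovationWeight_recent_le hd0 (by linarith) hc hb hn I)
    (sum_sq_innovationWeight_distant_le hd0.le hd hc hb hn I)

end PowerLaw

theorem isBigO_natCast_rpow_add_one {α : ℝ} (hα : α ≤ 0) :
    (fun j : ℕ => (j : ℝ) ^ α) =O[atTop] fun j : ℕ => ((j : ℝ) + 1) ^ α := by
  refine Asymptotics.IsBigO.of_bound ((2 : ℝ)⁻¹ ^ α) ?_
  filter_upwards [eventually_ge_atTop 1] with j hj
  have hj : (1 : ℝ) ≤ j := by exact_mod_cast hj
  rw [Real.norm_of_nonneg (by positivity), Real.norm_of_nonneg (by positivity),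
    ← Real.mul_rpow (by norm_num) (by positivity)]
  exact Real.rpow_le_rpow_of_nonpos (by positivity) (by linarith) hα

theorem LMSDCoeff.hasMemoryAtMost {d : ℝ} {b : ℕ → ℝ} (hb : LMSDCoeff d b) (hd0 : 0 ≤ d)
    (hd : d < 1 / 2) : HasMemoryAtMost d b := by
  rcases hd0.eq_or_lt with rfl | hpos
  · obtain ⟨C, a, -, ha, hCa⟩ := hb.2 rfl
    refine hasMemoryAtMost_zero_of_summable
      (summable_of_isBigO_nat (g := fun j : ℕ => |C * a ^ j|) ?_ hCa.isBigO.abs_abs)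
    simpa [abs_mul] using (summable_geometric_of_lt_one (abs_nonneg a) ha).mul_left |C|
  · obtain ⟨C, -, hC⟩ := hb.1 hpos
    obtain ⟨c, hc, hbound⟩ := Asymptotics.bound_of_isBigO_nat_atTop
      (hC.isBigO.trans ((isBigO_natCast_rpow_add_one (by linarith)).const_mul_left C))
    refine hasMemoryAtMost_of_abs_le_rpow hpos hd hc.le fun j => ?_
    have hj : (0 : ℝ) < ((j : ℝ) + 1) ^ (d - 1) := by positivity
    simpa [abs_of_pos hj] using hbound (x := j) hj.ne'

end Coefficients

theorem indepFun_restrict_of_notMem {ι Ω : Type*} [MeasurableSpace Ω] {P : Measure Ω}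
    {Z : ι → Ω → ℝ} (hm : ∀ i, Measurable (Z i)) (hZ : iIndepFun Z P) {I : Finset ι} {i : ι}
    (hi : i ∉ I) : IndepFun (fun ω (j : I) => Z j ω) (Z i) P :=
  (hZ.indepFun_finset I {i} (Finset.disjoint_singleton_right.2 hi) hm).comp (φ := id)
    (ψ := fun z : ({i} : Finset ι) → ℝ => z ⟨i, Finset.mem_singleton_self i⟩) measurable_id
    (measurable_pi_apply (⟨i, Finset.mem_singleton_self i⟩ : ({i} : Finset ι)))

theorem indepFun_comp_of_dependsOn {ι Ω : Type*} [MeasurableSpace Ω] {P : Measure Ω}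
    {Z : ι → Ω → ℝ} (hm : ∀ i, Measurable (Z i)) (hZ : iIndepFun Z P) {I : Finset ι} {i : ι}
    (hi : i ∉ I) {F : (ι → ℝ) → ℝ} (hF : Measurable F) (hFI : DependsOn F (I : Set ι))
    {ψ : ℝ → ℝ} (hψ : Measurable ψ) :
    IndepFun (fun ω => F (Z · ω)) (fun ω => ψ (Z i ω)) P := by
  classical
  have hpast := indepFun_restrict_of_notMem hm hZ hi
  have hfactor (ω : Ω) :
      F (Z · ω) = F fun j => if h : j ∈ I then (fun j : I => Z j ω) ⟨j, h⟩ else 0 :=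
    hFI fun j hj => by simp [Finset.mem_coe.1 hj]
  simp only [hfactor]
  exact hpast.comp (φ := fun z : I → ℝ => F fun j => if h : j ∈ I then z ⟨j, h⟩ else 0)
    (hF.comp (measurable_pi_lambda _ fun j => by split_ifs <;> fun_prop)) hψ

section GaussianNoise

/-- A family of independent centred Gaussian random variables of common variance `v`. -/
structure IsGaussianNoise {ι Ω : Type*} [MeasurableSpace Ω] (P : Measure Ω) (v : ℝ≥0)
    (Z : ι → Ω → ℝ) : Prop where
  measurable : ∀ i, Measurable (Z i)
  map_eq : ∀ i, P.map (Z i) = gaussianReal 0 v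
  indep : iIndepFun Z P

/-- The Wick exponential `exp (s x)` of a centred Gaussian variable `x` of variance `v`: it is
normalized to have mean one. -/
noncomputable def wickExp (v : ℝ≥0) (s x : ℝ) : ℝ := Real.exp (s * x - v * s ^ 2 / 2)

/-- The Wick exponential of the linear form `∑ i ∈ I, c i * z i` in independent centred Gaussian
variables `z i` of variance `v`. -/
noncomputable def wickProd {ι : Type*} (v : ℝ≥0) (c : ι → ℝ) (I : Finset ι) (z : ι → ℝ) : ℝ :=
  ∏ i ∈ I, wickExp v (c i) (z i)

variable {ι Ω : Type*} {v : ℝ≥0}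

theorem wickExp_pos (v : ℝ≥0) (s x : ℝ) : 0 < wickExp v s x := Real.exp_pos _

@[fun_prop]
theorem measurable_wickExp (v : ℝ≥0) (s : ℝ) : Measurable (wickExp v s) := by
  unfold wickExp
  fun_prop

theorem wickExp_pow (v : ℝ≥0) (s x : ℝ) (q : ℕ) :
    wickExp v s x ^ q = Real.exp (v / 2 * ((q : ℝ) ^ 2 - q) * s ^ 2) * wickExp v (q * s) x := by
  rw [wickExp, wickExp, ← Real.exp_nat_mul, ← Real.exp_add]
  ring_nf

theorem integral_wickExp_gaussianReal (v : ℝ≥0) (s : ℝ) :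
    ∫ x, wickExp v s x ∂gaussianReal 0 v = 1 := by
  have hmgf := congrFun (mgf_id_gaussianReal (μ := 0) (v := v)) s
  simp only [mgf, id_eq, zero_mul, zero_add] at hmgf
  simp only [wickExp, Real.exp_sub]
  rw [integral_div, hmgf, div_self (Real.exp_ne_zero _)]

theorem abs_exp_sub_one_le_mul_exp_abs (t : ℝ) : |Real.exp t - 1| ≤ |t| * Real.exp |t| := by
  rcases le_total 0 t with ht | ht
  · have hexp := mul_le_mul_of_nonneg_left (Real.one_sub_le_exp_neg t) (Real.exp_pos t).le
    rw [← Real.exp_add, add_neg_cancel, Real.exp_zero] at hexp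
    rw [abs_of_nonneg ht, abs_of_nonneg (by linarith [Real.one_le_exp ht])]
    linarith
  · rw [abs_of_nonpos ht, abs_of_nonpos (by linarith [Real.exp_le_one_iff.2 ht])]
    have hexp : 1 ≤ Real.exp (-t) := Real.one_le_exp (by linarith)
    nlinarith [Real.add_one_le_exp t]

theorem abs_wickExp_sub_one_le {s R : ℝ} (hs : |s| ≤ R) (x : ℝ) :
    |wickExp v s x - 1| ≤ |s| * Real.exp ((R + 1) * (|x| + v * R)) := by
  have hR : 0 ≤ R := (abs_nonneg s).trans hs
  set w := |x| + v * R with hw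
  have hexponent : |s * x - v * s ^ 2 / 2| ≤ |s| * w := by
    calc |s * x - v * s ^ 2 / 2| ≤ |s * x| + |v * s ^ 2 / 2| := abs_sub _ _
      _ = |s| * |x| + v * |s| * |s| / 2 := by
        rw [abs_mul, abs_of_nonneg (a := v * s ^ 2 / 2) (by positivity), ← sq_abs s]
        ring
      _ ≤ |s| * |x| + v * |s| * R := by
        gcongr
        exact (half_le_self (by positivity)).trans (by gcongr)
      _ = |s| * w := by rw [hw]; ring
  calc |wickExp v s x - 1| ≤ _ := abs_exp_sub_one_le_mul_exp_abs _
    _ ≤ |s| * w * Real.exp (R * w) := by gcongr; exact hexponent.trans (by gcongr)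
    _ ≤ |s| * Real.exp w * Real.exp (R * w) := by gcongr; linarith [Real.add_one_le_exp w]
    _ = |s| * Real.exp ((R + 1) * w) := by rw [mul_assoc, ← Real.exp_add]; ring_nf

theorem wickProd_pos (v : ℝ≥0) (c : ι → ℝ) (I : Finset ι) (z : ι → ℝ) : 0 < wickProd v c I z :=
  Finset.prod_pos fun i _ => wickExp_pos v (c i) (z i)

@[fun_prop]
theorem measurable_wickProd (v : ℝ≥0) (c : ι → ℝ) (I : Finset ι) : Measurable (wickProd v c I) := by
  unfold wickProd
  fun_prop

theorem dependsOn_wickProd (v : ℝ≥0) (c : ι → ℝ) (I : Finset ι) :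
    DependsOn (wickProd v c I) (I : Set ι) :=
  fun _ _ h => Finset.prod_congr rfl fun i hi => by rw [h i hi]

theorem wickProd_insert [DecidableEq ι] {c : ι → ℝ} {I : Finset ι} {i : ι} (hi : i ∉ I)
    (z : ι → ℝ) : wickProd v c (insert i I) z = wickProd v c I z * wickExp v (c i) (z i) := by
  rw [wickProd, Finset.prod_insert hi, mul_comm, wickProd]

theorem wickProd_eq_exp (v : ℝ≥0) (c : ι → ℝ) (I : Finset ι) (z : ι → ℝ) :
    wickProd v c I z = Real.exp (∑ i ∈ I, c i * z i - v * (∑ i ∈ I, c i ^ 2) / 2) := by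
  simp only [wickProd, wickExp]
  rw [← Real.exp_sum, Finset.sum_sub_distrib, Finset.mul_sum, Finset.sum_div]

theorem wickProd_pow (v : ℝ≥0) (c : ι → ℝ) (I : Finset ι) (z : ι → ℝ) (q : ℕ) :
    wickProd v c I z ^ q = Real.exp (v / 2 * ((q : ℝ) ^ 2 - q) * ∑ i ∈ I, c i ^ 2) *
      wickProd v (fun i => q * c i) I z := by
  simp only [wickProd]
  rw [← Finset.prod_pow, Finset.mul_sum, Real.exp_sum, ← Finset.prod_mul_distrib]
  exact Finset.prod_congr rfl fun i _ => wickExp_pow v (c i) (z i) q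

variable [MeasurableSpace Ω] {P : Measure Ω} {Z : ι → Ω → ℝ}

namespace IsGaussianNoise

theorem integral_comp (hZ : IsGaussianNoise P v Z) (i : ι) {f : ℝ → ℝ} (hf : Measurable f) :
    ∫ ω, f (Z i ω) ∂P = ∫ x, f x ∂gaussianReal 0 v := by
  rw [← hZ.map_eq i, integral_map (hZ.measurable i).aemeasurable hf.aestronglyMeasurable]

theorem integrable_exp_mul (hZ : IsGaussianNoise P v Z) (i : ι) (t : ℝ) :
    Integrable (fun ω => Real.exp (t * Z i ω)) P := by
  have hgauss := integrable_exp_mul_gaussianReal (μ := 0) (v := v) t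
  rw [← hZ.map_eq i] at hgauss
  exact hgauss.comp_measurable (hZ.measurable i)

theorem hasMoments_exp_abs (hZ : IsGaussianNoise P v Z) (i : ι) (s t : ℝ) :
    HasMoments (fun ω => Real.exp (s * (|Z i ω| + t))) P := by
  have := hZ.measurable i
  refine .of_integrable_abs_pow (by fun_prop) fun q => ?_
  have hexp := (integrable_exp_mul_abs (hZ.integrable_exp_mul i (q * s))
    (hZ.integrable_exp_mul i (-(q * s)))).mul_const (Real.exp (q * s * t))
  refine hexp.congr (ae_of_all _ fun ω => ?_)
  simp only [Real.abs_exp]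
  rw [← Real.exp_nat_mul, ← Real.exp_add]
  ring_nf

theorem hasMoments_wickExp (hZ : IsGaussianNoise P v Z) (i : ι) (s : ℝ) :
    HasMoments (fun ω => wickExp v s (Z i ω)) P := by
  refine .of_integrable_abs_pow
    ((measurable_wickExp v s).comp (hZ.measurable i)).aestronglyMeasurable fun q => ?_
  simp only [abs_of_pos (wickExp_pos v s _), wickExp_pow]
  simp only [wickExp, Real.exp_sub]
  exact ((hZ.integrable_exp_mul i (q * s)).div_const _).const_mul _

theorem integral_wickExp_sub_one (hZ : IsGaussianNoise P v Z) [IsProbabilityMeasure P] (i : ι)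
    (s : ℝ) : ∫ ω, (wickExp v s (Z i ω) - 1) ∂P = 0 := by
  rw [integral_sub (hZ.hasMoments_wickExp i s).integrable (integrable_const 1),
    hZ.integral_comp i (measurable_wickExp v s), integral_wickExp_gaussianReal]
  simp

theorem hasMoments_wickProd (hZ : IsGaussianNoise P v Z) [IsFiniteMeasure P] (c : ι → ℝ)
    (I : Finset ι) : HasMoments (fun ω => wickProd v c I (Z · ω)) P := by
  classical
  induction I using Finset.induction_on with
  | empty => exact .const 1
  | insert i I hi ih =>
    simp only [wickProd_insert hi]
    exact ih.mul (hZ.hasMoments_wickExp i (c i))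

theorem integral_wickProd (hZ : IsGaussianNoise P v Z) (c : ι → ℝ) (I : Finset ι) :
    ∫ ω, wickProd v c I (Z · ω) ∂P = 1 := by
  have hindep : iIndepFun (fun (i : I) ω => wickExp v (c i) (Z i ω)) P :=
    (hZ.indep.precomp Subtype.val_injective).comp (fun i : I => wickExp v (c i))
      fun i => measurable_wickExp v (c i)
  simp only [wickProd, ← Finset.prod_coe_sort I]
  rw [hindep.integral_fun_prod_eq_prod_integral fun i =>
    ((measurable_wickExp v (c i)).comp (hZ.measurable i)).aestronglyMeasurable]
  exact Finset.prod_eq_one fun i _ => by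
    rw [hZ.integral_comp i (measurable_wickExp v (c i)), integral_wickExp_gaussianReal]

theorem integral_wickProd_pow_le (hZ : IsGaussianNoise P v Z) {c : ι → ℝ} {I : Finset ι} {Q : ℝ}
    (hQ : ∑ i ∈ I, c i ^ 2 ≤ Q) (q : ℕ) :
    ∫ ω, wickProd v c I (Z · ω) ^ q ∂P ≤ Real.exp (v / 2 * (q : ℝ) ^ 2 * Q) := by
  simp only [wickProd_pow]
  rw [integral_const_mul, hZ.integral_wickProd, mul_one]
  have : 0 ≤ ∑ i ∈ I, c i ^ 2 := Finset.sum_nonneg fun _ _ => sq_nonneg _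
  gcongr
  linarith [q.cast_nonneg (α := ℝ)]

theorem integral_wickProd_mul_comp_pow_le (hZ : IsGaussianNoise P v Z) [IsFiniteMeasure P]
    {c : ι → ℝ} {I : Finset ι} {Q : ℝ} (hQ : ∑ i ∈ I, c i ^ 2 ≤ Q) {i : ι} (hi : i ∉ I)
    {G : ℝ → ℝ} (hG : Measurable G) (hG0 : ∀ x, 0 ≤ G x)
    (hGmom : HasMoments (fun ω => G (Z i ω)) P) (q : ℕ) :
    ∫ ω, (wickProd v c I (Z · ω) * G (Z i ω)) ^ q ∂P ≤
      Real.exp (v / 2 * (q : ℝ) ^ 2 * Q) * ∫ x, G x ^ q ∂gaussianReal 0 v := by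
  have hindep : IndepFun (fun ω => wickProd v c I (Z · ω) ^ q) (fun ω => G (Z i ω) ^ q) P :=
    indepFun_comp_of_dependsOn hZ.measurable hZ.indep hi
      (F := fun z => wickProd v c I z ^ q) (by fun_prop)
      (fun _ _ h => by simp only [dependsOn_wickProd v c I h]) (hG.pow_const _)
  simp only [mul_pow]
  rw [hindep.integral_fun_mul_eq_mul_integral
    ((hZ.hasMoments_wickProd c I).pow _).aestronglyMeasurable (hGmom.pow _).aestronglyMeasurable,
    hZ.integral_comp i (hG.pow_const _)]
  refine mul_le_mul_of_nonneg_right (hZ.integral_wickProd_pow_le hQ _) ?_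
  exact integral_nonneg fun x => pow_nonneg (hG0 x) _

variable {κ : Type*} [IsProbabilityMeasure P]

theorem integral_sum_wickProd_mul_pow_le (hZ : IsGaussianNoise P v Z) {R Q : ℝ} (K : Finset κ)
    {c : κ → ι → ℝ} {I : Finset ι} (hQ : ∀ k, ∑ i ∈ I, c k i ^ 2 ≤ Q) {i : ι} (hi : i ∉ I)
    (hR : ∀ k, |c k i| ≤ R) (m : ℕ) :
    ∫ ω, (∑ k ∈ K, wickProd v (c k) I (Z · ω) * (wickExp v (c k i) (Z i ω) - 1)) ^ (2 * (m + 1)) ∂P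
      ≤ (∑ k ∈ K, |c k i|) ^ (2 * (m + 1)) *
        (Real.exp (v / 2 * ((2 * (m + 1) : ℕ) : ℝ) ^ 2 * Q) *
          ∫ x, Real.exp ((R + 1) * (|x| + v * R)) ^ (2 * (m + 1)) ∂gaussianReal 0 v) := by
  set G : ℝ → ℝ := fun x => Real.exp ((R + 1) * (|x| + v * R))
  have hG : Measurable G := by fun_prop
  have hGmom : HasMoments (fun ω => G (Z i ω)) P := hZ.hasMoments_exp_abs i _ _
  have hW := fun k => hZ.hasMoments_wickProd (c k) I
  have hpointwise (ω : Ω) :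
      (∑ k ∈ K, wickProd v (c k) I (Z · ω) * (wickExp v (c k i) (Z i ω) - 1)) ^ (2 * (m + 1)) ≤
        (∑ k ∈ K, |c k i| * (wickProd v (c k) I (Z · ω) * G (Z i ω))) ^ (2 * (m + 1)) := by
    rw [← (even_two_mul (m + 1)).pow_abs]
    refine pow_le_pow_left₀ (abs_nonneg _) ((Finset.abs_sum_le_sum_abs _ _).trans ?_) _
    refine Finset.sum_le_sum fun k _ => ?_
    rw [abs_mul, abs_of_pos (wickProd_pos _ _ _ _), mul_left_comm]
    exact mul_le_mul_of_nonneg_left (abs_wickExp_sub_one_le (hR k) _) (wickProd_pos _ _ _ _).le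
  refine (integral_mono ((HasMoments.sum K fun k _ => (hW k).mul
    ((hZ.hasMoments_wickExp i _).sub (.const 1))).pow _).integrable
    ((HasMoments.sum K fun k _ => ((hW k).mul hGmom).const_mul _).pow _).integrable
    hpointwise).trans ?_
  exact integral_sum_mul_pow_le K (2 * m + 1) (fun k => abs_nonneg _)
    (fun k => (hW k).mul hGmom) (fun k ω => (mul_pos (wickProd_pos _ _ _ _) (Real.exp_pos _)).le)
    fun k =>
      hZ.integral_wickProd_mul_comp_pow_le (hQ k) hi hG (fun _ => (Real.exp_pos _).le) hGmom _

theorem integral_mul_sum_wickProd_mul_eq_zero (hZ : IsGaussianNoise P v Z) (K : Finset κ)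
    (c : κ → ι → ℝ) {I : Finset ι} {i : ι} (hi : i ∉ I) {F : (ι → ℝ) → ℝ} (hF : Measurable F)
    (hFI : DependsOn F (I : Set ι)) (hFmom : HasMoments (fun ω => F (Z · ω)) P) :
    ∫ ω, F (Z · ω) * ∑ k ∈ K, wickProd v (c k) I (Z · ω) * (wickExp v (c k i) (Z i ω) - 1) ∂P
      = 0 := by
  have hincr := fun k => (hZ.hasMoments_wickExp i (c k i)).sub (.const 1)
  have hpast := fun k => hFmom.mul (hZ.hasMoments_wickProd (c k) I)
  simp only [Finset.mul_sum, ← mul_assoc]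
  rw [integral_finsetSum K fun k _ => ((hpast k).mul (hincr k)).integrable]
  refine Finset.sum_eq_zero fun k _ => ?_
  have hindep : IndepFun (fun ω => F (Z · ω) * wickProd v (c k) I (Z · ω))
      (fun ω => wickExp v (c k i) (Z i ω) - 1) P :=
    indepFun_comp_of_dependsOn hZ.measurable hZ.indep hi
      (F := fun z => F z * wickProd v (c k) I z) (by fun_prop)
      (fun _ _ h => by simp only [hFI h, dependsOn_wickProd v (c k) I h])
      ((measurable_wickExp v (c k i)).sub_const 1)
  rw [hindep.integral_fun_mul_eq_mul_integral (hpast k).aestronglyMeasurable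
    (hincr k).aestronglyMeasurable, hZ.integral_wickExp_sub_one, mul_zero]

theorem exists_integral_sum_wickProd_sub_one_pow_le (hZ : IsGaussianNoise P v Z) (Q : ℝ) (m : ℕ) :
    ∃ A : ℝ, 0 ≤ A ∧ ∀ (K : Finset κ) (c : κ → ι → ℝ), (∀ k I, ∑ i ∈ I, c k i ^ 2 ≤ Q) →
      ∀ I : Finset ι, ∫ ω, (∑ k ∈ K, (wickProd v (c k) I (Z · ω) - 1)) ^ (2 * (m + 1)) ∂P ≤
        (A * ∑ i ∈ I, (∑ k ∈ K, |c k i|) ^ 2) ^ (m + 1) := by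
  classical
  set D := Real.exp (v / 2 * ((2 * (m + 1) : ℕ) : ℝ) ^ 2 * Q) *
    ∫ x, Real.exp ((√Q + 1) * (|x| + v * √Q)) ^ (2 * (m + 1)) ∂gaussianReal 0 v
  have hD : 0 ≤ D :=
    mul_nonneg (Real.exp_pos _).le (integral_nonneg fun x => pow_nonneg (Real.exp_pos _).le _)
  refine ⟨16 ^ (m + 1) * (1 + D), by positivity, fun K c hQ I => ?_⟩
  have hincrement (J : Finset ι) (i : ι) (hi : i ∉ J) (ω : Ω) :
      ∑ k ∈ K, (wickProd v (c k) (insert i J) (Z · ω) - 1) -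
        ∑ k ∈ K, (wickProd v (c k) J (Z · ω) - 1) =
      ∑ k ∈ K, wickProd v (c k) J (Z · ω) * (wickExp v (c k i) (Z i ω) - 1) := by
    rw [← Finset.sum_sub_distrib]
    exact Finset.sum_congr rfl fun k _ => by rw [wickProd_insert hi]; ring
  have hmom (J : Finset ι) :
      HasMoments (fun ω => ∑ k ∈ K, (wickProd v (c k) J (Z · ω) - 1)) P :=
    .sum K fun k _ => (hZ.hasMoments_wickProd (c k) J).sub (.const 1)
  have hbound := integral_pow_le_of_orthogonal_increments m
    (a := fun i => (1 + D) * (∑ k ∈ K, |c k i|) ^ 2) hmom (by simp [wickProd])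
    (fun i => by positivity) ?_ ?_ I
  · rwa [← Finset.mul_sum, ← mul_assoc] at hbound
  · intro J i hi
    simp only [hincrement J i hi]
    exact hZ.integral_mul_sum_wickProd_mul_eq_zero K c hi
      (F := fun z => (∑ k ∈ K, (wickProd v (c k) J z - 1)) ^ (2 * m + 1)) (by fun_prop)
      (fun _ _ h => by simp only [fun k => dependsOn_wickProd v (c k) J h]) ((hmom J).pow _)
  · intro J i hi
    simp only [hincrement J i hi]
    have hR (k : κ) : |c k i| ≤ √Q := Real.abs_le_sqrt (by simpa using hQ k {i})
    refine (hZ.integral_sum_wickProd_mul_pow_le K (hQ · J) hi hR m).trans ?_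
    rw [mul_pow, ← pow_mul, mul_comm]
    gcongr
    exact (by linarith : D ≤ 1 + D).trans (le_self_pow₀ (by linarith) (by omega))

end IsGaussianNoise

end GaussianNoise

theorem indepFun_prodMk_left {Ω α β γ : Type*} [MeasurableSpace Ω] [MeasurableSpace α]
    [MeasurableSpace β] [MeasurableSpace γ] {P : Measure Ω} [IsProbabilityMeasure P] {f : Ω → α}
    {g : Ω → β} {h : Ω → γ} (hf : Measurable f) (hg : Measurable g) (hh : Measurable h)
    (hfgh : IndepFun f (fun ω => (g ω, h ω)) P) (hgh : IndepFun g h P) :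
    IndepFun (fun ω => (f ω, g ω)) h P := by
  have hfg : IndepFun f g P := hfgh.comp (φ := id) (ψ := Prod.fst) measurable_id measurable_fst
  have : IsProbabilityMeasure (P.map f) := Measure.isProbabilityMeasure_map hf.aemeasurable
  have : IsProbabilityMeasure (P.map g) := Measure.isProbabilityMeasure_map hg.aemeasurable
  have : IsProbabilityMeasure (P.map h) := Measure.isProbabilityMeasure_map hh.aemeasurable
  rw [indepFun_iff_map_prod_eq_prod_map_map (by fun_prop) (by fun_prop)] at *
  rw [hfg, ← MeasurableEquiv.prodAssoc.map_measurableEquiv_injective.eq_iff,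
    Measure.prodAssoc_prod, ← hgh, ← hfgh,
    Measure.map_map MeasurableEquiv.prodAssoc.measurable (by fun_prop)]
  rfl

/-- A family of independent centred random variables with finite moments, the moments of order
`q` being bounded by `H q`. -/
structure IsCentredNoise {κ Ω : Type*} [MeasurableSpace Ω] (P : Measure Ω) (H : ℕ → ℝ)
    (η : κ → Ω → ℝ) : Prop where
  measurable : ∀ k, Measurable (η k)
  indep : iIndepFun η P
  hasMoments : ∀ k, HasMoments (η k) P
  integral_eq_zero : ∀ k, ∫ ω, η k ω ∂P = 0
  integral_pow_le : ∀ k q, ∫ ω, η k ω ^ q ∂P ≤ H q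

namespace IsCentredNoise

variable {κ Ω α : Type*} [MeasurableSpace Ω] [MeasurableSpace α] {P : Measure Ω}
  [IsProbabilityMeasure P] {H : ℕ → ℝ} {η : κ → Ω → ℝ} {g : Ω → α} {φ : κ → α → ℝ}

theorem indepFun_prodMk_restrict (hη : IsCentredNoise P H η) (hg : Measurable g)
    (hind : IndepFun g (fun ω k => η k ω) P) {s : Finset κ} {k : κ} (hk : k ∉ s) :
    IndepFun (fun ω => (g ω, fun j : s => η j ω)) (η k) P := by
  have := hη.measurable
  refine indepFun_prodMk_left hg (by fun_prop) (hη.measurable k) ?_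
    (indepFun_restrict_of_notMem hη.measurable hη.indep hk)
  exact hind.comp (φ := id) (ψ := fun y : κ → ℝ => ((fun j : s => y j), y k)) measurable_id
    (by fun_prop)

theorem integral_sum_pow_mul_eq_zero (hη : IsCentredNoise P H η) (hg : Measurable g)
    (hind : IndepFun g (fun ω k => η k ω) P) (hφ : ∀ k, Measurable (φ k))
    (hφmom : ∀ k, HasMoments (fun ω => φ k (g ω)) P) (q : ℕ) {s : Finset κ} {k : κ} (hk : k ∉ s) :
    ∫ ω, (∑ j ∈ s, φ j (g ω) * η j ω) ^ q * (φ k (g ω) * η k ω) ∂P = 0 := by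
  have hindep : IndepFun (fun ω => (∑ j ∈ s, φ j (g ω) * η j ω) ^ q * φ k (g ω)) (η k) P := by
    simp only [← Finset.sum_coe_sort s]
    exact (hη.indepFun_prodMk_restrict hg hind hk).comp (ψ := id)
      (φ := fun z : α × (s → ℝ) => (∑ j : s, φ j z.1 * z.2 j) ^ q * φ k z.1) (by fun_prop)
      measurable_id
  have hmom : HasMoments (fun ω => (∑ j ∈ s, φ j (g ω) * η j ω) ^ q * φ k (g ω)) P :=
    ((HasMoments.sum s fun j _ => (hφmom j).mul (hη.hasMoments j)).pow q).mul (hφmom k)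
  simp only [← mul_assoc]
  rw [hindep.integral_fun_mul_eq_mul_integral hmom.aestronglyMeasurable
    (hη.hasMoments k).aestronglyMeasurable, hη.integral_eq_zero, mul_zero]

theorem integral_mul_pow_le (hη : IsCentredNoise P H η)
    (hind : IndepFun g (fun ω k => η k ω) P) (hφ : ∀ k, Measurable (φ k))
    (hφmom : ∀ k, HasMoments (fun ω => φ k (g ω)) P) {q : ℕ} (hq : Even q) {D : ℝ}
    (hφD : ∀ k, ∫ ω, φ k (g ω) ^ q ∂P ≤ D) (k : κ) :
    ∫ ω, (φ k (g ω) * η k ω) ^ q ∂P ≤ D * H q := by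
  have hindep : IndepFun (fun ω => φ k (g ω) ^ q) (fun ω => η k ω ^ q) P :=
    hind.comp (φ := fun x => φ k x ^ q) (ψ := fun y : κ → ℝ => y k ^ q) (by fun_prop) (by fun_prop)
  simp only [mul_pow]
  rw [hindep.integral_fun_mul_eq_mul_integral ((hφmom k).pow q).aestronglyMeasurable
    ((hη.hasMoments k).pow q).aestronglyMeasurable]
  exact mul_le_mul (hφD k) (hη.integral_pow_le k q) (integral_nonneg fun ω => hq.pow_nonneg _)
    ((integral_nonneg fun ω => hq.pow_nonneg _).trans (hφD k))

theorem integral_sum_mul_pow_le (hη : IsCentredNoise P H η) (hg : Measurable g)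
    (hind : IndepFun g (fun ω k => η k ω) P) (hφ : ∀ k, Measurable (φ k))
    (hφmom : ∀ k, HasMoments (fun ω => φ k (g ω)) P) (m : ℕ) {D : ℝ}
    (hφD : ∀ k, ∫ ω, φ k (g ω) ^ (2 * (m + 1)) ∂P ≤ D) (s : Finset κ) :
    ∫ ω, (∑ k ∈ s, φ k (g ω) * η k ω) ^ (2 * (m + 1)) ∂P ≤
      (16 ^ (m + 1) * (1 + |D * H (2 * (m + 1))|) * s.card) ^ (m + 1) := by
  classical
  have hbound := integral_pow_le_of_orthogonal_increments m
    (a := fun _ => 1 + |D * H (2 * (m + 1))|)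
    (fun s => HasMoments.sum s fun k _ => (hφmom k).mul (hη.hasMoments k)) (by simp)
    (fun _ => by positivity) ?_ ?_ s
  · rwa [Finset.sum_const, nsmul_eq_mul, mul_comm (s.card : ℝ), ← mul_assoc] at hbound
  · intro t k hk
    simp only [Finset.sum_insert hk, add_sub_cancel_right]
    exact hη.integral_sum_pow_mul_eq_zero hg hind hφ hφmom _ hk
  · intro t k hk
    simp only [Finset.sum_insert hk, add_sub_cancel_right]
    refine (hη.integral_mul_pow_le hind hφ hφmom (even_two_mul _) hφD k).trans ?_
    exact ((le_abs_self _).trans (le_add_of_nonneg_left zero_le_one)).trans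
      (le_self_pow₀ (le_add_of_nonneg_right (abs_nonneg _)) (by omega))

end IsCentredNoise

section LimitsAndRecentring

variable {Ω : Type*} [MeasurableSpace Ω] {P : Measure Ω}

theorem exists_subseq_forall_tendsto_ae {ι : Type*} (s : Finset ι) {f : ι → ℕ → Ω → ℝ}
    {g : ι → Ω → ℝ} (h : ∀ k ∈ s, TendstoInMeasure P (f k) atTop (g k)) :
    ∃ u : ℕ → ℕ, StrictMono u ∧
      ∀ᵐ ω ∂P, ∀ k ∈ s, Tendsto (fun i => f k (u i) ω) atTop (𝓝 (g k ω)) := by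
  classical
  induction s using Finset.induction_on with
  | empty => exact ⟨id, strictMono_id, by simp⟩
  | insert k s _ ih =>
    obtain ⟨u, hu, hus⟩ := ih fun j hj => h j (Finset.mem_insert_of_mem hj)
    have hku : TendstoInMeasure P (fun i => f k (u i)) atTop (g k) := fun ε hε =>
      (h k (Finset.mem_insert_self k s) ε hε).comp hu.tendsto_atTop
    obtain ⟨w, hw, hwk⟩ := hku.exists_seq_tendsto_ae
    refine ⟨u ∘ w, hu.comp hw, ?_⟩
    filter_upwards [hus, hwk] with ω hωs hωk
    exact (Finset.forall_mem_insert _ _ _).2 ⟨hωk, fun j hj => (hωs j hj).comp hw.tendsto_atTop⟩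

theorem lintegral_ofReal_le_of_tendsto_ae {F : ℕ → Ω → ℝ} {f : Ω → ℝ} {B : ℝ}
    (hF : ∀ i, Integrable (F i) P) (hF0 : ∀ i ω, 0 ≤ F i ω) (hB : ∀ i, ∫ ω, F i ω ∂P ≤ B)
    (hlim : ∀ᵐ ω ∂P, Tendsto (fun i => F i ω) atTop (𝓝 (f ω))) :
    ∫⁻ ω, ENNReal.ofReal (f ω) ∂P ≤ ENNReal.ofReal B := by
  calc ∫⁻ ω, ENNReal.ofReal (f ω) ∂P
      = ∫⁻ ω, liminf (fun i => ENNReal.ofReal (F i ω)) atTop ∂P := by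
        refine lintegral_congr_ae ?_
        filter_upwards [hlim] with ω hω
        exact ((ENNReal.continuous_ofReal.tendsto _).comp hω).liminf_eq.symm
    _ ≤ liminf (fun i => ∫⁻ ω, ENNReal.ofReal (F i ω) ∂P) atTop :=
        lintegral_liminf_le' fun i => (hF i).1.aemeasurable.ennreal_ofReal
    _ ≤ ENNReal.ofReal B := by
        refine liminf_le_of_frequently_le' (Frequently.of_forall fun i => ?_)
        rw [← ofReal_integral_eq_lintegral_ofReal (hF i) (ae_of_all _ (hF0 i))]
        exact ENNReal.ofReal_le_ofReal (hB i)

theorem integrable_and_integral_le_of_tendsto_ae {F : ℕ → Ω → ℝ} {f : Ω → ℝ} {B : ℝ}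
    (hF : ∀ i, Integrable (F i) P) (hF0 : ∀ i ω, 0 ≤ F i ω) (hB : ∀ i, ∫ ω, F i ω ∂P ≤ B)
    (hlim : ∀ᵐ ω ∂P, Tendsto (fun i => F i ω) atTop (𝓝 (f ω))) :
    Integrable f P ∧ ∫ ω, f ω ∂P ≤ B := by
  have hf0 : 0 ≤ᵐ[P] f := by
    filter_upwards [hlim] with ω hω using ge_of_tendsto' hω fun i => hF0 i ω
  have hfatou := lintegral_ofReal_le_of_tendsto_ae hF hF0 hB hlim
  have hf : Integrable f P := by
    refine ⟨aestronglyMeasurable_of_tendsto_ae atTop (fun i => (hF i).1) hlim, ?_⟩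
    rw [hasFiniteIntegral_iff_ofReal hf0]
    exact hfatou.trans_lt ENNReal.ofReal_lt_top
  refine ⟨hf, ?_⟩
  rw [← ofReal_integral_eq_lintegral_ofReal hf hf0] at hfatou
  exact (ENNReal.ofReal_le_ofReal_iff ((integral_nonneg (hF0 0)).trans (hB 0))).1 hfatou

theorem abs_pow_le_one_add_pow {p q : ℕ} (hpq : p ≤ 2 * q) (x : ℝ) : |x| ^ p ≤ 1 + x ^ (2 * q) := by
  rw [← (even_two_mul q).pow_abs]
  rcases le_total |x| 1 with hx | hx
  · linarith [pow_le_one₀ (n := p) (abs_nonneg x) hx, pow_nonneg (abs_nonneg x) (2 * q)]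
  · linarith [pow_le_pow_right₀ hx hpq]

variable [IsProbabilityMeasure P]

theorem pow_integral_sub_le {Y : Ω → ℝ} {q : ℕ} (hq : Even q) (hY : Integrable Y P) (c : ℝ)
    (hYc : Integrable (fun ω => (Y ω - c) ^ q) P) :
    (∫ ω, Y ω ∂P - c) ^ q ≤ ∫ ω, (Y ω - c) ^ q ∂P := by
  have hjensen := hq.convexOn_pow.map_integral_le (continuous_pow q).continuousOn isClosed_univ
    (ae_of_all P fun ω => Set.mem_univ (Y ω - c)) (hY.sub (integrable_const c)) hYc
  rwa [integral_sub hY (integrable_const c), integral_const, probReal_univ, one_smul] at hjensen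

theorem integral_sub_integral_pow_le {Y : Ω → ℝ} {m : ℕ} (hY : Integrable Y P) {c : ℝ}
    (hYc : Integrable (fun ω => (Y ω - c) ^ (2 * (m + 1))) P) :
    Integrable (fun ω => (Y ω - ∫ ω', Y ω' ∂P) ^ (2 * (m + 1))) P ∧
      ∫ ω, (Y ω - ∫ ω', Y ω' ∂P) ^ (2 * (m + 1)) ∂P ≤
        4 ^ (m + 1) * ∫ ω, (Y ω - c) ^ (2 * (m + 1)) ∂P := by
  set μ := ∫ ω, Y ω ∂P
  have hpointwise (ω : Ω) : (Y ω - μ) ^ (2 * (m + 1)) ≤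
      2 ^ (2 * m + 1) * ((Y ω - c) ^ (2 * (m + 1)) + (μ - c) ^ (2 * (m + 1))) := by
    have hadd := (even_two_mul (m + 1)).add_pow_le (a := Y ω - c) (b := c - μ)
    rwa [sub_add_sub_cancel, ← neg_sub μ c, (even_two_mul (m + 1)).neg_pow] at hadd
  have hbound := (hYc.add (integrable_const ((μ - c) ^ (2 * (m + 1))))).const_mul
    (2 ^ (2 * m + 1))
  have hYμ : Integrable (fun ω => (Y ω - μ) ^ (2 * (m + 1))) P :=
    hbound.mono' ((hY.sub (integrable_const μ)).aestronglyMeasurable.pow _) <|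
      ae_of_all _ fun ω => by
        rw [Real.norm_of_nonneg ((even_two_mul _).pow_nonneg _)]
        exact hpointwise ω
  refine ⟨hYμ, ?_⟩
  calc ∫ ω, (Y ω - μ) ^ (2 * (m + 1)) ∂P
      ≤ ∫ ω, 2 ^ (2 * m + 1) * ((Y ω - c) ^ (2 * (m + 1)) + (μ - c) ^ (2 * (m + 1))) ∂P :=
        integral_mono hYμ hbound hpointwise
    _ = 2 ^ (2 * m + 1) * (∫ ω, (Y ω - c) ^ (2 * (m + 1)) ∂P + (μ - c) ^ (2 * (m + 1))) := by
        rw [integral_const_mul, integral_add hYc (integrable_const _), integral_const,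
          probReal_univ, one_smul]
    _ ≤ 2 ^ (2 * m + 1) * (∫ ω, (Y ω - c) ^ (2 * (m + 1)) ∂P +
          ∫ ω, (Y ω - c) ^ (2 * (m + 1)) ∂P) := by
        gcongr
        exact pow_integral_sub_le (even_two_mul _) hY c hYc
    _ = 4 ^ (m + 1) * ∫ ω, (Y ω - c) ^ (2 * (m + 1)) ∂P := by
        rw [show (4 : ℝ) = 2 ^ 2 by norm_num, ← pow_mul]
        ring

theorem integral_abs_sub_integral_pow_le {Y : Ω → ℝ} {c B : ℝ} {p m : ℕ} (hp : p ≤ 2 * (m + 1))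
    (hY : AEStronglyMeasurable Y P) (hYc : Integrable (fun ω => (Y ω - c) ^ (2 * (m + 1))) P)
    (hB : ∫ ω, (Y ω - c) ^ (2 * (m + 1)) ∂P ≤ B) :
    Integrable Y P ∧ Integrable (fun ω => |Y ω - ∫ ω', Y ω' ∂P| ^ p) P ∧
      ∫ ω, |Y ω - ∫ ω', Y ω' ∂P| ^ p ∂P ≤ 1 + 4 ^ (m + 1) * B := by
  have hlower {a : ℝ} {r : ℕ} (hr : r ≤ 2 * (m + 1))
      (ha : Integrable (fun ω => (Y ω - a) ^ (2 * (m + 1))) P) :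
      Integrable (fun ω => |Y ω - a| ^ r) P :=
    integrable_norm_pow_of_le (f := fun ω => Y ω - a) (hY.sub aestronglyMeasurable_const) hr
      (by simpa only [Real.norm_eq_abs, (even_two_mul (m + 1)).pow_abs] using ha)
  have hYint : Integrable Y P := by
    have habs := hlower (r := 1) (by omega) hYc
    simp only [pow_one] at habs
    have hsub : Integrable (fun ω => Y ω - c) P :=
      (integrable_norm_iff (hY.sub aestronglyMeasurable_const)).1 habs
    exact (hsub.add (integrable_const c)).congr (ae_of_all _ fun ω => sub_add_cancel (Y ω) c)
  obtain ⟨hYμ, hle⟩ := integral_sub_integral_pow_le hYint hYc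
  refine ⟨hYint, hlower hp hYμ, ?_⟩
  calc ∫ ω, |Y ω - ∫ ω', Y ω' ∂P| ^ p ∂P
      ≤ ∫ ω, (1 + (Y ω - ∫ ω', Y ω' ∂P) ^ (2 * (m + 1))) ∂P :=
        integral_mono (hlower hp hYμ) ((integrable_const 1).add hYμ)
          fun ω => abs_pow_le_one_add_pow hp _
    _ = 1 + ∫ ω, (Y ω - ∫ ω', Y ω' ∂P) ^ (2 * (m + 1)) ∂P := by
        rw [integral_add (integrable_const 1) hYμ, integral_const, probReal_univ, one_smul]
    _ ≤ 1 + 4 ^ (m + 1) * B := by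
        gcongr
        exact hle.trans (by gcongr)

end LimitsAndRecentring

section Duration

/-- The log-linear duration model `τ k = exp (h k) * ε k` with `h k = ∑_{j ≥ 0} b j * e (k - j)`,
where `e` is Gaussian noise of variance `v` and `ε` is an independent sequence of i.i.d. factors
with finite moments. -/
structure IsLogLinearDuration {Ω : Type*} [MeasurableSpace Ω] (P : Measure Ω) (v : ℝ≥0)
    (b : ℕ → ℝ) (e ε h τ : ℤ → Ω → ℝ) : Prop where
  isGaussianNoise : IsGaussianNoise P v e
  measurable_ε : ∀ k, Measurable (ε k)
  identDistrib_ε : ∀ k, IdentDistrib (ε k) (ε 0) P P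
  indep_ε : iIndepFun ε P
  hasMoments_ε : ∀ k, HasMoments (ε k) P
  indep_e_ε : IndepFun (fun ω k => e k ω) (fun ω k => ε k ω) P
  series_h : ∀ k : ℤ, TendstoInMeasure P
    (fun (N : ℕ) ω => ∑ j ∈ Finset.range N, b j * e (k - (j : ℤ)) ω) atTop (h k)
  duration_eq : ∀ k ω, τ k ω = Real.exp (h k ω) * ε k ω

/-- The partial sum `∑_{k=1}^n (W k * ε k - μ)`, where `W k` is the Wick exponential of the part of
`h k` carried by the innovations `e i` with `i ∈ I`. It is a rescaled and centred version of
`∑_{k=1}^n τ k`, involving finitely many random variables only. -/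
noncomputable def truncatedSum {Ω : Type*} (v : ℝ≥0) (b : ℕ → ℝ) (μ : ℝ) (e ε : ℤ → Ω → ℝ)
    (n : ℕ) (I : Finset ℤ) (ω : Ω) : ℝ :=
  ∑ k ∈ Finset.Icc 1 n, (wickProd v (fun i => causal b (k - i)) I (e · ω) * ε k ω - μ)

theorem truncatedSum_eq {Ω : Type*} (v : ℝ≥0) (b : ℕ → ℝ) (μ : ℝ) (e ε : ℤ → Ω → ℝ) (n : ℕ)
    (I : Finset ℤ) (ω : Ω) :
    truncatedSum v b μ e ε n I ω =
      μ * ∑ k ∈ Finset.Icc 1 n, (wickProd v (fun i => causal b (k - i)) I (e · ω) - 1) +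
        ∑ k ∈ Finset.Icc 1 n, wickProd v (fun i => causal b (k - i)) I (e · ω) * (ε k ω - μ) := by
  rw [truncatedSum, Finset.mul_sum, ← Finset.sum_add_distrib]
  exact Finset.sum_congr rfl fun k _ => by ring

theorem tendsto_wickProd_causal {b : ℕ → ℝ} (hb : Summable fun j => b j ^ 2) (v : ℝ≥0)
    {z : ℤ → ℝ} {x : ℝ} {k n : ℕ} (hk : k ≤ n) {u : ℕ → ℕ} (hu : Tendsto u atTop atTop)
    (hx : Tendsto (fun i => ∑ j ∈ Finset.range (k + u i + 1), b j * z (k - j)) atTop (𝓝 x)) :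
    Tendsto (fun i => wickProd v (fun l => causal b (k - l)) (Finset.Icc (-(u i : ℤ)) n) z) atTop
      (𝓝 (Real.exp (x - v * (∑' j, b j ^ 2) / 2))) := by
  have hshift : Tendsto (fun i => k + u i + 1) atTop atTop :=
    tendsto_atTop_mono (fun i => show u i ≤ k + u i + 1 by omega) hu
  have hvar := hb.hasSum.tendsto_sum_nat.comp hshift
  refine ((Real.continuous_exp.tendsto _).comp
    (hx.sub ((hvar.const_mul (v : ℝ)).div_const 2))).congr fun i => ?_
  rw [wickProd_eq_exp, sum_Icc_causal_eq_sum_range b hk (u i) (f := fun c l => c * z l) (by simp),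
    sum_Icc_causal_eq_sum_range b hk (u i) (f := fun c _ => c ^ 2) (by simp)]
  rfl

namespace IsLogLinearDuration

variable {Ω : Type*} [MeasurableSpace Ω] {P : Measure Ω} {v : ℝ≥0} {b : ℕ → ℝ}
  {e ε h τ : ℤ → Ω → ℝ} {d : ℝ}

theorem aestronglyMeasurable_normalizedSum (hτ : IsLogLinearDuration P v b e ε h τ) (d : ℝ)
    (n : ℕ) : AEStronglyMeasurable (normalizedSum d τ n) P := by
  have hh (k : ℤ) : AEMeasurable (h k) P :=
    (hτ.series_h k).aemeasurable fun N =>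
      (Finset.measurable_fun_sum _ fun j _ =>
        (hτ.isGaussianNoise.measurable _).const_mul (b j)).aemeasurable
  have hτm (k : ℤ) : AEMeasurable (τ k) P :=
    ((Real.measurable_exp.comp_aemeasurable (hh k)).mul (hτ.measurable_ε k).aemeasurable).congr
      (ae_of_all _ fun ω => (hτ.duration_eq k ω).symm)
  exact ((Finset.aemeasurable_fun_sum (Finset.Icc 1 n)
    fun k _ => hτm (k : ℕ)).div_const _).aestronglyMeasurable

theorem exists_tendsto_truncatedSum (hτ : IsLogLinearDuration P v b e ε h τ)
    (hb : Summable fun j => b j ^ 2) (μ : ℝ) (n : ℕ) :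
    ∃ I : ℕ → Finset ℤ, ∀ᵐ ω ∂P, Tendsto (fun i => truncatedSum v b μ e ε n (I i) ω) atTop
      (𝓝 (Real.exp (-(v * (∑' j, b j ^ 2) / 2)) * ∑ k ∈ Finset.Icc 1 n, τ k ω - n * μ)) := by
  have hseries (k : ℕ) : TendstoInMeasure P (fun (L : ℕ) ω =>
      ∑ j ∈ Finset.range (k + L + 1), b j * e (k - (j : ℤ)) ω) atTop (h k) := fun δ hδ =>
    (hτ.series_h k δ hδ).comp (tendsto_atTop_mono (fun L => show L ≤ k + L + 1 by omega) tendsto_id)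
  obtain ⟨u, hu, hus⟩ := exists_subseq_forall_tendsto_ae (Finset.Icc 1 n) fun k _ => hseries k
  refine ⟨fun i => Finset.Icc (-(u i : ℤ)) n, ?_⟩
  filter_upwards [hus] with ω hω
  have hterm (k : ℕ) (hk : k ∈ Finset.Icc 1 n) :=
    tendsto_wickProd_causal hb v (z := (e · ω)) (Finset.mem_Icc.1 hk).2 hu.tendsto_atTop (hω k hk)
  have hlimit : Real.exp (-(v * (∑' j, b j ^ 2) / 2)) * ∑ k ∈ Finset.Icc 1 n, τ k ω - n * μ =
      ∑ k ∈ Finset.Icc 1 n, (Real.exp (h k ω - v * (∑' j, b j ^ 2) / 2) * ε k ω - μ) := by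
    simp only [hτ.duration_eq, sub_eq_neg_add (h _ ω), Real.exp_add, mul_assoc]
    rw [Finset.sum_sub_distrib, Finset.sum_const, Nat.card_Icc, Nat.add_sub_cancel, nsmul_eq_mul,
      Finset.mul_sum]
  rw [hlimit]
  exact tendsto_finsetSum _ fun k hk => ((hterm k hk).mul_const (ε k ω)).sub_const μ

variable [IsProbabilityMeasure P]

theorem hasMoments_truncatedSum (hτ : IsLogLinearDuration P v b e ε h τ) (μ : ℝ) (n : ℕ)
    (I : Finset ℤ) : HasMoments (truncatedSum v b μ e ε n I) P :=
  HasMoments.sum _ fun k _ =>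
    ((hτ.isGaussianNoise.hasMoments_wickProd _ I).mul (hτ.hasMoments_ε k)).sub (.const μ)

theorem isCentredNoise_sub_integral (hτ : IsLogLinearDuration P v b e ε h τ) :
    IsCentredNoise P (fun q => ∫ ω, (ε 0 ω - ∫ ω', ε 0 ω' ∂P) ^ q ∂P)
      (fun (k : ℕ) ω => ε k ω - ∫ ω', ε 0 ω' ∂P) where
  measurable k := (hτ.measurable_ε k).sub_const _
  indep := (hτ.indep_ε.precomp Nat.cast_injective).comp (fun _ x => x - ∫ ω', ε 0 ω' ∂P)
    fun _ => measurable_id.sub_const _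
  hasMoments k := (hτ.hasMoments_ε k).sub (.const _)
  integral_eq_zero k := by
    rw [integral_sub (hτ.hasMoments_ε k).integrable (integrable_const _),
      (hτ.identDistrib_ε k).integral_eq, integral_const, probReal_univ, one_smul, sub_self]
  integral_pow_le k q := ((hτ.identDistrib_ε k).comp
    (u := fun x => (x - ∫ ω', ε 0 ω' ∂P) ^ q) (by fun_prop)).integral_eq.le

theorem exists_integral_sum_wickProd_causal_sub_one_pow_le
    (hτ : IsLogLinearDuration P v b e ε h τ) (hb : HasMemoryAtMost d b) (m : ℕ) :
    ∃ A : ℝ, ∀ n : ℕ, 1 ≤ n → ∀ I : Finset ℤ,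
      ∫ ω, (∑ k ∈ Finset.Icc 1 n, (wickProd v (fun i => causal b (k - i)) I (e · ω) - 1))
        ^ (2 * (m + 1)) ∂P ≤ (A * (n : ℝ) ^ (1 + 2 * d)) ^ (m + 1) := by
  have hQ (k : ℕ) (I : Finset ℤ) := sum_causal_sq_le_tsum hb.summable_sq k I
  obtain ⟨C, hC⟩ := hb
  obtain ⟨A, hA0, hA⟩ := hτ.isGaussianNoise.exists_integral_sum_wickProd_sub_one_pow_le
    (κ := ℕ) (∑' j, b j ^ 2) m
  refine ⟨A * C, fun n hn I =>
    (hA (Finset.Icc 1 n) (fun k i => causal b (k - i)) hQ I).trans ?_⟩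
  rw [mul_assoc]
  gcongr
  exact hC n hn I

theorem exists_integral_sum_wickProd_causal_mul_pow_le (hτ : IsLogLinearDuration P v b e ε h τ)
    (hb : Summable fun j => b j ^ 2) (m : ℕ) :
    ∃ A : ℝ, 0 ≤ A ∧ ∀ (n : ℕ) (I : Finset ℤ),
      ∫ ω, (∑ k ∈ Finset.Icc 1 n, wickProd v (fun i => causal b (k - i)) I (e · ω) *
        (ε k ω - ∫ ω', ε 0 ω' ∂P)) ^ (2 * (m + 1)) ∂P ≤ (A * n) ^ (m + 1) := by
  have hnoise := hτ.isGaussianNoise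
  have hmeas : Measurable fun ω k => e k ω := measurable_pi_lambda _ hnoise.measurable
  have hind : IndepFun (fun ω k => e k ω)
      (fun ω (k : ℕ) => ε k ω - ∫ ω', ε 0 ω' ∂P) P :=
    hτ.indep_e_ε.comp (φ := id)
      (ψ := fun (y : ℤ → ℝ) (k : ℕ) => y k - ∫ ω', ε 0 ω' ∂P) measurable_id (by fun_prop)
  refine ⟨16 ^ (m + 1) * (1 + |Real.exp (v / 2 * ((2 * (m + 1) : ℕ) : ℝ) ^ 2 * ∑' j, b j ^ 2) *
    ∫ ω, (ε 0 ω - ∫ ω', ε 0 ω' ∂P) ^ (2 * (m + 1)) ∂P|), by positivity, fun n I =>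
    (hτ.isCentredNoise_sub_integral.integral_sum_mul_pow_le hmeas hind
    (φ := fun (k : ℕ) z => wickProd v (fun i => causal b (k - i)) I z)
    (fun k => measurable_wickProd _ _ _) (fun k => hnoise.hasMoments_wickProd _ I) m
    (fun k => hnoise.integral_wickProd_pow_le (sum_causal_sq_le_tsum hb k I) _)
    (Finset.Icc 1 n)).trans_eq ?_⟩
  rw [Nat.card_Icc, Nat.add_sub_cancel]

theorem exists_integral_truncatedSum_pow_le (hτ : IsLogLinearDuration P v b e ε h τ)
    (hd0 : 0 ≤ d) (hb : HasMemoryAtMost d b) (m : ℕ) :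
    ∃ B : ℝ, ∀ n : ℕ, 1 ≤ n → ∀ I : Finset ℤ,
      ∫ ω, truncatedSum v b (∫ ω', ε 0 ω' ∂P) e ε n I ω ^ (2 * (m + 1)) ∂P ≤
        B * ((n : ℝ) ^ (1 + 2 * d)) ^ (m + 1) := by
  obtain ⟨A, hA⟩ := hτ.exists_integral_sum_wickProd_causal_sub_one_pow_le hb m
  obtain ⟨A', hA'0, hA'⟩ := hτ.exists_integral_sum_wickProd_causal_mul_pow_le hb.summable_sq m
  have hη := hτ.isCentredNoise_sub_integral
  set μ := ∫ ω, ε 0 ω ∂P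
  refine ⟨2 ^ (2 * (m + 1) - 1) * (μ ^ (2 * (m + 1)) * A ^ (m + 1) + A' ^ (m + 1)),
    fun n hn I => ?_⟩
  set N := (n : ℝ) ^ (1 + 2 * d)
  have hnN : (n : ℝ) ≤ N :=
    Real.self_le_rpow_of_one_le (by exact_mod_cast hn) (by linarith)
  have hW (k : ℕ) := hτ.isGaussianNoise.hasMoments_wickProd (fun i => causal b (k - i)) I
  have hsplit := integral_add_pow_two_mul_le
    ((HasMoments.sum (Finset.Icc 1 n) fun k _ => (hW k).sub (.const 1)).const_mul μ)
    (HasMoments.sum (Finset.Icc 1 n) fun k _ =>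
      (hW k).mul (hη.hasMoments k)) (m + 1)
  simp only [← truncatedSum_eq, mul_pow μ, integral_const_mul] at hsplit
  refine hsplit.trans ?_
  rw [mul_assoc, add_mul, mul_assoc, ← mul_pow, ← mul_pow A']
  gcongr
  · exact (even_two_mul _).pow_nonneg _
  · exact hA n hn I
  · exact (hA' n I).trans (by gcongr)

theorem exists_integral_sum_sub_pow_le (hτ : IsLogLinearDuration P v b e ε h τ) (hd0 : 0 ≤ d)
    (hb : HasMemoryAtMost d b) (m : ℕ) :
    ∃ a c B : ℝ, 0 < a ∧ ∀ n : ℕ, 1 ≤ n →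
      Integrable (fun ω => (a * ∑ k ∈ Finset.Icc 1 n, τ k ω - n * c) ^ (2 * (m + 1))) P ∧
      ∫ ω, (a * ∑ k ∈ Finset.Icc 1 n, τ k ω - n * c) ^ (2 * (m + 1)) ∂P ≤
        B * ((n : ℝ) ^ (1 + 2 * d)) ^ (m + 1) := by
  obtain ⟨B, hB⟩ := hτ.exists_integral_truncatedSum_pow_le hd0 hb m
  refine ⟨Real.exp (-(v * (∑' j, b j ^ 2) / 2)), ∫ ω, ε 0 ω ∂P, B, Real.exp_pos _, fun n hn => ?_⟩
  obtain ⟨I, hI⟩ := hτ.exists_tendsto_truncatedSum hb.summable_sq (∫ ω, ε 0 ω ∂P) n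
  exact integrable_and_integral_le_of_tendsto_ae
    (fun i => ((hτ.hasMoments_truncatedSum _ n (I i)).pow (2 * (m + 1))).integrable)
    (fun i ω => (even_two_mul _).pow_nonneg _) (fun i => hB n hn (I i))
    (hI.mono fun ω hω => hω.pow _)

theorem exists_integral_normalizedSum_sub_pow_le (hτ : IsLogLinearDuration P v b e ε h τ)
    (hd0 : 0 ≤ d) (hb : HasMemoryAtMost d b) (m : ℕ) :
    ∃ B : ℝ, ∀ n : ℕ, 1 ≤ n → ∃ c : ℝ,
      Integrable (fun ω => (normalizedSum d τ n ω - c) ^ (2 * (m + 1))) P ∧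
      ∫ ω, (normalizedSum d τ n ω - c) ^ (2 * (m + 1)) ∂P ≤ B := by
  obtain ⟨a, c, B, ha, hB⟩ := hτ.exists_integral_sum_sub_pow_le hd0 hb m
  refine ⟨B / a ^ (2 * (m + 1)), fun n hn => ⟨n * c / (a * (n : ℝ) ^ (1 / 2 + d)), ?_⟩⟩
  obtain ⟨hint, hle⟩ := hB n hn
  have hn0 : (0 : ℝ) < n := by exact_mod_cast hn
  have hscale (ω : Ω) : normalizedSum d τ n ω - n * c / (a * (n : ℝ) ^ (1 / 2 + d)) =
      (a * ∑ k ∈ Finset.Icc 1 n, τ k ω - n * c) / (a * (n : ℝ) ^ (1 / 2 + d)) := by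
    rw [normalizedSum, sub_div, mul_div_mul_left _ _ ha.ne']
  have hpow : ((n : ℝ) ^ (1 / 2 + d)) ^ 2 = (n : ℝ) ^ (1 + 2 * d) := by
    rw [← Real.rpow_mul_natCast hn0.le]
    congr 1
    push_cast
    ring
  simp only [hscale, div_pow, integral_div]
  refine ⟨hint.div_const _, ?_⟩
  rw [mul_pow, ← div_div, pow_mul ((n : ℝ) ^ (1 / 2 + d)), hpow, div_right_comm]
  gcongr
  exact (div_le_iff₀ (by positivity)).2 hle

end IsLogLinearDuration

theorem IsLMSD.exists_isLogLinearDuration {Ω : Type*} [MeasurableSpace Ω] {P : Measure Ω} {d : ℝ}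
    {b : ℕ → ℝ} {e ε h τ : ℤ → Ω → ℝ} (hτ : IsLMSD P d b e ε h τ) :
    ∃ v, IsLogLinearDuration P v b e ε h τ := by
  obtain ⟨v, hv⟩ := hτ.gaussian_e
  exact ⟨v, ⟨hτ.measurable_e, hv, hτ.indep_e⟩, hτ.measurable_ε, hτ.identDistrib_ε, hτ.indep_ε,
    fun k => .of_integrable_abs_pow (hτ.measurable_ε k).aestronglyMeasurable (hτ.moments_ε k),
    hτ.indep_e_ε, hτ.series_h, hτ.duration_eq⟩

end Duration

theorem lemma1_general {Ω : Type*} [MeasurableSpace Ω] {P : Measure Ω} [IsProbabilityMeasure P]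
    {d : ℝ} (hd0 : 0 ≤ d) {v : ℝ≥0} {b : ℕ → ℝ} (hb : HasMemoryAtMost d b)
    {e ε h τ : ℤ → Ω → ℝ} (hτ : IsLogLinearDuration P v b e ε h τ) (p : ℕ) :
    ∃ M : ℝ, ∀ n : ℕ, 1 ≤ n →
      Integrable (normalizedSum d τ n) P ∧
      Integrable (fun ω => |normalizedSum d τ n ω - ∫ ω', normalizedSum d τ n ω' ∂P| ^ p) P ∧
      ∫ ω, |normalizedSum d τ n ω - ∫ ω', normalizedSum d τ n ω' ∂P| ^ p ∂P ≤ M := by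
  obtain ⟨B, hB⟩ := hτ.exists_integral_normalizedSum_sub_pow_le hd0 hb p
  refine ⟨1 + 4 ^ (p + 1) * B, fun n hn => ?_⟩
  obtain ⟨c, hint, hle⟩ := hB n hn
  exact integral_abs_sub_integral_pow_le (by omega) (hτ.aestronglyMeasurable_normalizedSum d n)
    hint hle

theorem lemma1 {Ω : Type*} [MeasurableSpace Ω] (P : Measure Ω) [IsProbabilityMeasure P]
    (d : ℝ) (hd0 : 0 ≤ d) (hd : d < 1 / 2) (b : ℕ → ℝ) (e ε h τ : ℤ → Ω → ℝ)
    (hτ : IsLMSD P d b e ε h τ) (p : ℕ) (hp : 2 ≤ p) :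
    ∃ M : ℝ, ∀ n : ℕ, 1 ≤ n →
      Integrable (normalizedSum d τ n) P ∧
      Integrable (fun ω => |normalizedSum d τ n ω - ∫ ω', normalizedSum d τ n ω' ∂P| ^ p) P ∧
      ∫ ω, |normalizedSum d τ n ω - ∫ ω', normalizedSum d τ n ω' ∂P| ^ p ∂P ≤ M := by
  obtain ⟨_, hlin⟩ := hτ.exists_isLogLinearDuration
  exact lemma1_general hd0 (hτ.coeff.hasMemoryAtMost hd0 hd) hlin p
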